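/- Lemma 4.1 (Poisson cohomology ≅ 0-de Rham cohomology). Let $S$ be a smooth surface (a Hausdorff, second countable $2$-manifold without boundary) with a star divisor $D=\{Z_1,\dots,Z_n\}$, i.e. a finite collection of smooth curves, each a closed embedded submanifold of $S$, that are pairwise transverse. Let ${}^bTS$ be the Lie algebroid whose sections are the smooth vector fields on $S$ tangent to every $Z_i$, and let ${}^0TS$ (the zero tangent bundle) be the Lie algebroid whose sections are the smooth vector fields on $S$ that vanish at every point of every $Z_i$; in both cases the anchor is evaluation in $TS$ and the bracket is induced by the Lie bracket of vector fields. Let $\omega$ be a star log symplectic structure on $(S,D)$, i.e. a closed nondegenerate section of $\wedge^2({}^bT^*S)$, and let $\pi$ be the associated star log Poisson structure: the bivector field on $S$ with $\pi^\sharp=(\omega^\flat)^{-1}$, i.e. for every smooth $1$-form $\alpha$ on $S$, $\pi^\sharp(\alpha)=\pi(\alpha,\cdot)$ is the section $u$ of ${}^bTS$ with $\omega(u,v)=\alpha(v)$ for all sections $v$ of ${}^bTS$. Let $H^k_\pi(S)$ be the Poisson cohomology of $\pi$, i.e. the cohomology of the complex $\Gamma(\wedge^\bullet TS)$ of multivector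 fields with the Lichnerowicz differential, which is the Lie algebroid differential of $T^*S$ with anchor $\pi^\sharp$ and bracket $[\alpha,\beta]=\mathcal L_{\pi^\sharp(\alpha)}\beta-\mathcal L_{\pi^\sharp(\beta)}\alpha-d(\pi(\alpha,\beta))$. Let ${}^0H^k(S)$ be the Lie algebroid cohomology of ${}^0TS$. Then, for every $k\ge 0$, $$H^k_\pi(S)\;\cong\;{}^0H^k(S)$$ as real vector spaces. Moreover the rigged Lie algebroid of $\omega$, whose sections are the sections $u$ of ${}^bTS$ for which there is a smooth $1$-form $\alpha$ on $S$ with $\omega(u,v)=\alpha(v)$ for all sections $v$ of ${}^bTS$, coincides with the zero tangent bundle ${}^0TS$ (same sections, with bracket and anchor those induced from $TS$). -/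

import Mathlib

open scoped Manifold ContDiff

noncomputable section

namespace StarLog

/-! ### Lie algebroid forms and their cohomology, on the level of global sections

`R` is the algebra of smooth functions.  A Lie algebroid is given by its `R`-module of sections
`A`, its bracket and its anchor; its `k`-forms, i.e. the sections of the `k`-th exterior power of
the dual bundle, are the `R`-multilinear alternating maps `A ^ k → R`. -/

section Algebra

variable {R : Type*} [CommRing R] [Algebra ℝ R]

/-- Vector fields, as derivations of the algebra of smooth functions.  They form an `R`-module,
and Mathlib's bracket on them is the commutator, i.e. the Lie bracket of vector fields. -/
abbrev VField (R : Type*) [CommRing R] [Algebra ℝ R] : Type _ := Derivation ℝ R R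

/-- One-forms: the `R`-module dual of the vector fields. -/
abbrev OneForm (R : Type*) [CommRing R] [Algebra ℝ R] : Type _ := Module.Dual R (VField R)

/-- Bivector fields: alternating `R`-bilinear maps on one-forms. -/
abbrev Bivector (R : Type*) [CommRing R] [Algebra ℝ R] : Type _ := OneForm R [⋀^Fin 2]→ₗ[R] R

section Cohomology

variable {A : Type*} [AddCommGroup A] [Module R A]

variable (R A) in
/-- The `k`-forms of the Lie algebroid, as a real vector space. -/
def Form (k : ℕ) : Type _ := A [⋀^Fin k]→ₗ[R] R

instance (k : ℕ) : AddCommGroup (Form R A k) := inferInstanceAs (AddCommGroup (A [⋀^Fin k]→ₗ[R] R))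

instance (k : ℕ) : Module ℝ (Form R A k) := inferInstanceAs (Module ℝ (A [⋀^Fin k]→ₗ[R] R))

instance (k : ℕ) : CoeFun (Form R A k) (fun _ => (Fin k → A) → R) :=
  ⟨fun β => (show A [⋀^Fin k]→ₗ[R] R from β)⟩

/-- The bracket part `∑_{i<j} (-1)^(i+j) β([v_i, v_j], v_0, …, v̂_i, …, v̂_j, …, v_k)` of the
differential.  For a form of positive degree `m + 1` the pair is written `i`, `j + 1` with
`i ≤ j` in `Fin (m + 1)`; the remaining arguments are listed in increasing order. -/
def bracketPart (br : A → A → A) :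
    {k : ℕ} → (A [⋀^Fin k]→ₗ[R] R) → (Fin (k + 1) → A) → R
  | 0, _, _ => 0
  | m + 1, β, v =>
      ∑ j : Fin (m + 1), ∑ i ∈ Finset.Iic j, (-1 : R) ^ ((i : ℕ) + ((j : ℕ) + 1)) *
        β (Fin.cons (br (v i.castSucc) (v j.succ))
          (fun l : Fin m => v (j.succ.succAbove (i.succAbove l))))

/-- The Lie algebroid differential
`(dβ)(v_0, …, v_k) = ∑_i (-1)^i ρ(v_i)(β(v_0, …, v̂_i, …, v_k))
  + ∑_{i<j} (-1)^(i+j) β([v_i, v_j], v_0, …, v̂_i, …, v̂_j, …, v_k)`. -/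
def algebroidD (br : A → A → A) (ρ : A → VField R) {k : ℕ} (β : A [⋀^Fin k]→ₗ[R] R)
    (v : Fin (k + 1) → A) : R :=
  (∑ i : Fin (k + 1), (-1 : R) ^ (i : ℕ) * ρ (v i) (β (fun l => v (i.succAbove l))))
    + bracketPart br β v

theorem algebroidD_add (br : A → A → A) (ρ : A → VField R) {k : ℕ}
    (β γ : A [⋀^Fin k]→ₗ[R] R) (v : Fin (k + 1) → A) :
    algebroidD br ρ (β + γ) v = algebroidD br ρ β v + algebroidD br ρ γ v := by
  cases k with
  | zero => simp [algebroidD, bracketPart]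
  | succ m =>
    simp only [algebroidD, bracketPart, AlternatingMap.add_apply, map_add, mul_add,
      Finset.sum_add_distrib]
    ring

theorem algebroidD_smul (br : A → A → A) (ρ : A → VField R) {k : ℕ} (c : ℝ)
    (β : A [⋀^Fin k]→ₗ[R] R) (v : Fin (k + 1) → A) :
    algebroidD br ρ (c • β) v = c • algebroidD br ρ β v := by
  cases k with
  | zero => simp [algebroidD, bracketPart]
  | succ m =>
    simp only [algebroidD, bracketPart, AlternatingMap.smul_apply, mul_smul_comm,
      Finset.smul_sum, smul_add, Derivation.map_smul]

variable (R) in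
/-- Closed `k`-forms of the Lie algebroid. -/
def cocycles (br : A → A → A) (ρ : A → VField R) (k : ℕ) : Submodule ℝ (Form R A k) where
  carrier := {β | ∀ v, algebroidD br ρ β v = 0}
  add_mem' := fun {a b} ha hb v =>
    (algebroidD_add br ρ a b v).trans (by rw [ha v, hb v, add_zero])
  zero_mem' := fun v => by
    have h := algebroidD_smul br ρ (0 : ℝ) (0 : A [⋀^Fin k]→ₗ[R] R) v
    rw [zero_smul, zero_smul] at h
    exact h
  smul_mem' := fun c β hb v => (algebroidD_smul br ρ c β v).trans (by rw [hb v, smul_zero])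

variable (R) in
/-- Exact `k`-forms of the Lie algebroid. -/
def coboundaries (br : A → A → A) (ρ : A → VField R) : (k : ℕ) → Submodule ℝ (Form R A k)
  | 0 => ⊥
  | k + 1 =>
    { carrier := {β | ∃ γ : Form R A k, ∀ v, β v = algebroidD br ρ γ v}
      add_mem' := by
        rintro a b ⟨γ, hγ⟩ ⟨δ, hδ⟩
        refine ⟨γ + δ, fun v => Eq.trans ?_ (algebroidD_add br ρ γ δ v).symm⟩
        rw [← hγ v, ← hδ v]
        rfl
      zero_mem' := ⟨0, fun v => by
        have h := algebroidD_smul br ρ (0 : ℝ) (0 : A [⋀^Fin k]→ₗ[R] R) v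
        rw [zero_smul, zero_smul] at h
        exact h.symm⟩
      smul_mem' := by
        rintro c a ⟨γ, hγ⟩
        refine ⟨c • γ, fun v => Eq.trans ?_ (algebroidD_smul br ρ c γ v).symm⟩
        rw [← hγ v]
        rfl }

variable (R) in
/-- The Lie algebroid cohomology in degree `k`: closed forms modulo exact forms. -/
abbrev AlgebroidCohomology (br : A → A → A) (ρ : A → VField R) (k : ℕ) : Type _ :=
  cocycles R br ρ k ⧸ (coboundaries R br ρ k).submoduleOf (cocycles R br ρ k)

end Cohomology

/-! ### Poisson cohomology -/

/-- The differential of a function: `(df)(X) = X f`. -/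
def dFun (f : R) : OneForm R where
  toFun X := X f
  map_add' _ _ := rfl
  map_smul' _ _ := rfl

/-- The Lie derivative of a one-form: `(L_X β)(Y) = X(β(Y)) - β([X, Y])`. -/
def lieDer (X : VField R) (β : OneForm R) : OneForm R where
  toFun Y := X (β Y) - β ⁅X, Y⁆
  map_add' Y Z := by
    simp only [map_add, lie_add]
    ring
  map_smul' f Y := by
    have h : ⁅X, f • Y⁆ = (X f) • Y + f • ⁅X, Y⁆ := by
      ext g
      simp only [Derivation.commutator_apply, Derivation.add_apply, Derivation.smul_apply,
        smul_eq_mul, Derivation.leibniz]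
      ring
    simp only [map_smul, h, map_add, smul_eq_mul, Derivation.leibniz, RingHom.id_apply]
    ring

theorem bivector_smul_right (π : Bivector R) (α β : OneForm R) (f : R) :
    π ![α, f • β] = f * π ![α, β] := by
  have h (x : OneForm R) : ![α, x] = Function.update ![α, 0] 1 x := by
    ext i : 1
    fin_cases i <;> simp
  rw [h (f • β), h β, π.map_update_smul, smul_eq_mul]

theorem bivector_add_right (π : Bivector R) (α β γ : OneForm R) :
    π ![α, β + γ] = π ![α, β] + π ![α, γ] := by
  have h (x : OneForm R) : ![α, x] = Function.update ![α, 0] 1 x := by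
    ext i : 1
    fin_cases i <;> simp
  rw [h (β + γ), h β, h γ, π.map_update_add]

theorem bivector_dFun_add (π : Bivector R) (α : OneForm R) (f g : R) :
    π ![α, dFun (f + g)] = π ![α, dFun f] + π ![α, dFun g] := by
  have h : (dFun (f + g) : OneForm R) = dFun f + dFun g := by
    ext X
    simp [dFun]
  rw [h]
  exact bivector_add_right π α (dFun f) (dFun g)

/-- The map `π♯` from one-forms to vector fields, `π♯ α = π(α, ·)`, that is
`(π♯ α) f = π(α, df)`. -/
def sharp (π : Bivector R) (α : OneForm R) : VField R :=
  Derivation.mk'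
    { toFun := fun f => π ![α, dFun f]
      map_add' := bivector_dFun_add π α
      map_smul' := fun c f => by
        have h : (dFun (c • f) : OneForm R) = (algebraMap ℝ R c) • dFun f := by
          ext X
          simp [dFun]
        rw [h, bivector_smul_right, RingHom.id_apply, Algebra.smul_def] }
    (fun f g => by
      have h : (dFun (f * g) : OneForm R) = f • dFun g + g • dFun f := by
        ext X
        simp [dFun]
      change π ![α, dFun (f * g)] = f • π ![α, dFun g] + g • π ![α, dFun f]
      rw [h, bivector_add_right, bivector_smul_right, bivector_smul_right]
      rfl)

/-- The bracket of one-forms defined by a bivector field,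
`[α, β] = L_{π♯ α} β - L_{π♯ β} α - d(π(α, β))`. -/
def cotangentBracket (π : Bivector R) (α β : OneForm R) : OneForm R :=
  lieDer (sharp π α) β - lieDer (sharp π β) α - dFun (π ![α, β])

/-- The Poisson cohomology of `π`: the cohomology of the multivector fields, i.e. of the
`R`-multilinear alternating maps on one-forms, under the Lichnerowicz differential, which is the
Lie algebroid differential of the cotangent bundle with anchor `π♯`. -/
abbrev PoissonCohomology (π : Bivector R) (k : ℕ) : Type _ :=
  AlgebroidCohomology R (cotangentBracket π) (sharp π) k

end Algebra

/-! ### Surfaces with a star divisor -/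

section Surface

variable {S : Type*} [TopologicalSpace S] [ChartedSpace (EuclideanSpace ℝ (Fin 2)) S]

/-- The algebra of smooth real functions on the surface `S`. -/
abbrev Smooth (S : Type*) [TopologicalSpace S] [ChartedSpace (EuclideanSpace ℝ (Fin 2)) S] :
    Type _ := C^∞⟮𝓡 2, S; 𝓘(ℝ, ℝ), ℝ⟯

/-- `Z` is a smooth curve which is a closed embedded submanifold: near each of its points it is the
zero set of a smooth function with nonzero differential. -/
def IsSmoothClosedCurve (Z : Set S) : Prop :=
  IsClosed Z ∧ ∀ p ∈ Z, ∃ f : Smooth S,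
    mfderiv (𝓡 2) 𝓘(ℝ, ℝ) f p ≠ 0 ∧ ∀ᶠ q in nhds p, (q ∈ Z ↔ f q = 0)

/-- The tangent space of `Z` at `p`: the tangent vectors of `S` killed by the differentials of all
smooth functions that vanish on `Z`. -/
def tangentTo (Z : Set S) (p : S) : Submodule ℝ (TangentSpace (𝓡 2) p) :=
  ⨅ (f : Smooth S) (_ : ∀ q ∈ Z, f q = 0),
    LinearMap.ker (mfderiv (𝓡 2) 𝓘(ℝ, ℝ) f p).toLinearMap

/-- A star divisor: a finite collection of smooth closed curves that are pairwise transverse. -/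
structure IsStarDivisor {n : ℕ} (D : Fin n → Set S) : Prop where
  curve : ∀ i, IsSmoothClosedCurve (D i)
  transverse : ∀ i j, i ≠ j → ∀ p ∈ D i ∩ D j, tangentTo (D i) p ⊔ tangentTo (D j) p = ⊤

variable {n : ℕ} (D : Fin n → Set S)

/-- Sections of the `b`-tangent bundle: the vector fields tangent to every curve of `D`. -/
def bFields : Submodule (Smooth S) (VField (Smooth S)) where
  carrier := {X | ∀ i, ∀ f : Smooth S, (∀ q ∈ D i, f q = 0) → ∀ q ∈ D i, (X f) q = 0}
  add_mem' := fun {X Y} hX hY i f hf q hq => by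
    change (X f) q + (Y f) q = 0
    rw [hX i f hf q hq, hY i f hf q hq, add_zero]
  zero_mem' := fun _ _ _ _ _ => rfl
  smul_mem' := fun g X hX i f hf q hq => by
    change g q * (X f) q = 0
    rw [hX i f hf q hq, mul_zero]

/-- Sections of the zero tangent bundle: the vector fields vanishing on every curve of `D`. -/
def zeroFields : Submodule (Smooth S) (VField (Smooth S)) where
  carrier := {X | ∀ i, ∀ q ∈ D i, ∀ f : Smooth S, (X f) q = 0}
  add_mem' := fun {X Y} hX hY i q hq f => by
    change (X f) q + (Y f) q = 0
    rw [hX i q hq f, hY i q hq f, add_zero]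
  zero_mem' := fun _ _ _ _ => rfl
  smul_mem' := fun g X hX i q hq f => by
    change g q * (X f) q = 0
    rw [hX i q hq f, mul_zero]

/-- The bracket of the `b`-tangent bundle, induced by that of vector fields. -/
def bBracket (X Y : bFields D) : bFields D :=
  ⟨⁅(X : VField (Smooth S)), (Y : VField (Smooth S))⁆, fun i f hf q hq => by
    rw [Derivation.commutator_apply]
    change ((X : VField (Smooth S)) ((Y : VField (Smooth S)) f)) q
      - ((Y : VField (Smooth S)) ((X : VField (Smooth S)) f)) q = 0
    rw [X.2 i _ (fun r hr => Y.2 i f hf r hr) q hq, Y.2 i _ (fun r hr => X.2 i f hf r hr) q hq,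
      sub_zero]⟩

/-- The bracket of the zero tangent bundle, induced by that of vector fields. -/
def zeroBracket (X Y : zeroFields D) : zeroFields D :=
  ⟨⁅(X : VField (Smooth S)), (Y : VField (Smooth S))⁆, fun i q hq f => by
    rw [Derivation.commutator_apply]
    change ((X : VField (Smooth S)) ((Y : VField (Smooth S)) f)) q
      - ((Y : VField (Smooth S)) ((X : VField (Smooth S)) f)) q = 0
    rw [X.2 i q hq _, Y.2 i q hq _, sub_zero]⟩

/-- The Lie algebroid cohomology of the zero tangent bundle; the anchor is evaluation. -/
abbrev ZeroCohomology (k : ℕ) : Type _ :=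
  AlgebroidCohomology (Smooth S) (zeroBracket D)
    (fun X : zeroFields D => (X : VField (Smooth S))) k

/-- Two-forms of the `b`-tangent bundle. -/
abbrev BTwoForm : Type _ := bFields D [⋀^Fin 2]→ₗ[Smooth S] (Smooth S)

/-- A star log symplectic structure: a `b`-two-form that is closed and nondegenerate, i.e. such
that `u ↦ Ω(u, ·)` is a bijection from the sections of the `b`-tangent bundle to those of its
dual. -/
structure IsStarLogSymplectic (Ω : BTwoForm D) : Prop where
  closed : ∀ v, algebroidD (R := Smooth S) (bBracket D)
    (fun X : bFields D => (X : VField (Smooth S))) Ω v = 0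
  nondegenerate : ∀ α : Module.Dual (Smooth S) (bFields D), ∃! u : bFields D,
    ∀ v : bFields D, Ω ![u, v] = α v

/-- The bivector field `π` on `S` is the inverse of the `b`-two-form `Ω`: `π♯ α` is the `b`-vector
field `u` with `Ω(u, ·) = α`. -/
def IsInverse (Ω : BTwoForm D) (π : Bivector (Smooth S)) : Prop :=
  ∀ (α : OneForm (Smooth S)) (u : bFields D),
    (∀ v : bFields D, Ω ![u, v] = α (v : VField (Smooth S))) →
      sharp π α = (u : VField (Smooth S))

variable {D}

theorem bTwoForm_add_left (Ω : BTwoForm D) (u u' v : bFields D) :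
    Ω ![u + u', v] = Ω ![u, v] + Ω ![u', v] := by
  have h (x : bFields D) : ![x, v] = Function.update ![0, v] 0 x := by
    ext i : 1
    fin_cases i <;> simp
  rw [h (u + u'), h u, h u', Ω.map_update_add]

theorem bTwoForm_smul_left (Ω : BTwoForm D) (f : Smooth S) (u v : bFields D) :
    Ω ![f • u, v] = f * Ω ![u, v] := by
  have h (x : bFields D) : ![x, v] = Function.update ![0, v] 0 x := by
    ext i : 1
    fin_cases i <;> simp
  rw [h (f • u), h u, Ω.map_update_smul, smul_eq_mul]

/-- Sections of the rigged Lie algebroid of `Ω`: the `b`-vector fields `u` for which `Ω(u, ·)` is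
(the restriction of) a smooth one-form on `S`.  Bracket and anchor are those of vector fields. -/
def rigged (Ω : BTwoForm D) : Submodule (Smooth S) (VField (Smooth S)) where
  carrier := {X | ∃ u : bFields D, (u : VField (Smooth S)) = X ∧
    ∃ α : OneForm (Smooth S), ∀ v : bFields D, Ω ![u, v] = α (v : VField (Smooth S))}
  add_mem' := by
    rintro X Y ⟨u, rfl, α, hα⟩ ⟨w, rfl, β, hβ⟩
    exact ⟨u + w, rfl, α + β, fun v => by
      rw [bTwoForm_add_left, hα v, hβ v, LinearMap.add_apply]⟩
  zero_mem' := ⟨0, rfl, 0, fun v => by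
    have h := bTwoForm_smul_left Ω 0 0 v
    simpa using h⟩
  smul_mem' := by
    rintro f X ⟨u, rfl, α, hα⟩
    exact ⟨f • u, rfl, f • α, fun v => by
      rw [bTwoForm_smul_left, hα v, LinearMap.smul_apply, smul_eq_mul]⟩

end Surface

end StarLog

end

/-!
Closedness of `ω` makes `π♯` compatible with the brackets, so `π♯` is an isomorphism of Lie
algebroids from `T*S` onto its image: it is injective because multiplying by a function that
vanishes exactly on `D` turns every vector field into a section of `ᵇTS` without losing information.
That image is the rigged algebroid by the definition of `π`, so everything rests on the equality of
the rigged algebroid with the zero tangent bundle.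

Let `u` be rigged, with `ω(u, ·)` a smooth one-form, and let `f` be an equation of a curve `Z` of
`D`. Since `df / f` is a section of the dual of `ᵇTS`, nondegeneracy produces a section `w` for
which `ω(w, ·)` has a pole along `Z`. On a surface `ω` is proportional to the Jacobian; comparing
the two on `u` and `w` shows that `u` vanishes on `Z`.

Conversely, let `u` vanish on `D`. By transversality the product `F` of local equations of the
curves generates the ideal of functions vanishing on `D`. Hence locally `u = F U` with `U` smooth,
and `ω(u, F X) = ω(F U, F X)`, which vanishes on `D`, is divisible by `F`. The quotients glue to a
smooth one-form extending `ω(u, ·)`.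
-/

open scoped Topology
open Filter Set

universe u

namespace StarLog

section Calculus

variable {E F : Type u} [NormedAddCommGroup E] [NormedSpace ℝ E] [ProperSpace E]
  [NormedAddCommGroup F] [NormedSpace ℝ F]

theorem hasFDerivAt_parametric_integral {f : E × ℝ → F} (hf : ContDiff ℝ 1 f) (x₀ : E) :
    HasFDerivAt (fun x => ∫ t in (0 : ℝ)..1, f (x, t))
      (∫ t in (0 : ℝ)..1, (fderiv ℝ f (x₀, t)).comp (ContinuousLinearMap.inl ℝ E ℝ)) x₀ := by
  have hf' : Continuous fun z : E × ℝ =>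
      (fderiv ℝ f z).comp (ContinuousLinearMap.inl ℝ E ℝ) :=
    (hf.continuous_fderiv one_ne_zero).clm_comp continuous_const
  obtain ⟨C, hC⟩ := ((isCompact_closedBall x₀ 1).prod
    (isCompact_Icc (a := (0 : ℝ)) (b := 1))).exists_bound_of_continuousOn hf'.continuousOn
  refine intervalIntegral.hasFDerivAt_integral_of_dominated_of_fderiv_le
    (F := fun x t => f (x, t)) (bound := fun _ => C)
    (F' := fun x t => (fderiv ℝ f (x, t)).comp (ContinuousLinearMap.inl ℝ E ℝ))
    (Metric.closedBall_mem_nhds x₀ one_pos) ?_ ?_ ?_ ?_ intervalIntegrable_const ?_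
  · exact Eventually.of_forall fun x =>
      (hf.continuous.comp (Continuous.prodMk_right x)).aestronglyMeasurable
  · exact (hf.continuous.comp (Continuous.prodMk_right x₀)).intervalIntegrable _ _
  · exact (hf'.comp (Continuous.prodMk_right x₀)).aestronglyMeasurable
  · refine Eventually.of_forall fun t ht x hx => hC _ ⟨hx, ?_⟩
    rw [uIoc_of_le zero_le_one] at ht
    exact Ioc_subset_Icc_self ht
  · exact Eventually.of_forall fun t _ x _ =>
      (hf.differentiable one_ne_zero (x, t)).hasFDerivAt.comp x (hasFDerivAt_prodMk_left x t)

theorem contDiff_parametric_integral {f : E × ℝ → F} (hf : ContDiff ℝ ∞ f) :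
    ContDiff ℝ ∞ fun x => ∫ t in (0 : ℝ)..1, f (x, t) := by
  refine contDiff_infty.2 fun n => ?_
  induction n generalizing F with
  | zero =>
    exact contDiff_zero.2 (continuous_iff_continuousAt.2 fun x =>
      (hasFDerivAt_parametric_integral (hf.of_le (by simp)) x).continuousAt)
  | succ n ih =>
    refine contDiff_succ_iff_hasFDerivAt.2
      ⟨_, ?_, hasFDerivAt_parametric_integral (hf.of_le (by simp))⟩
    exact ih (f := fun z => (fderiv ℝ f z).comp (ContinuousLinearMap.inl ℝ E ℝ))
      ((hf.fderiv_right (by simp)).clm_comp contDiff_const)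

/-- Hadamard's lemma, along the segments from `c z` to `z`. -/
theorem exists_contDiff_sub_eq_apply_sub {f : E → ℝ} (hf : ContDiff ℝ ∞ f) {c : E → E}
    (hc : ContDiff ℝ ∞ c) :
    ∃ L : E → E →L[ℝ] ℝ, ContDiff ℝ ∞ L ∧ (∀ z, f z - f (c z) = L z (z - c z)) ∧
      ∀ z, c z = z → L z = fderiv ℝ f z := by
  have hg : ContDiff ℝ ∞ fun w : E × ℝ => fderiv ℝ f (c w.1 + w.2 • (w.1 - c w.1)) :=
    (hf.fderiv_right (m := ∞) (by simp)).comp (by fun_prop)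
  refine ⟨fun z => ∫ t in (0 : ℝ)..1, fderiv ℝ f (c z + t • (z - c z)),
    contDiff_parametric_integral hg, fun z => ?_, fun z hz => by simp [hz]⟩
  have hcont : Continuous fun t : ℝ => fderiv ℝ f (c z + t • (z - c z)) :=
    hg.continuous.comp (Continuous.prodMk_right z)
  have hderiv (t : ℝ) : HasDerivAt (fun t : ℝ => f (c z + t • (z - c z)))
      (fderiv ℝ f (c z + t • (z - c z)) (z - c z)) t := by
    have hline : HasDerivAt (fun t : ℝ => c z + t • (z - c z)) (z - c z) t := by
      simpa using ((hasDerivAt_id t).smul_const (z - c z)).const_add (c z)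
    exact (hf.differentiable (by simp) _).hasFDerivAt.comp_hasDerivAt t hline
  beta_reduce
  rw [ContinuousLinearMap.intervalIntegral_apply (hcont.intervalIntegrable _ _),
    intervalIntegral.integral_eq_sub_of_hasDerivAt (fun t _ => hderiv t)
      ((hcont.clm_apply continuous_const).intervalIntegrable _ _)]
  simp

end Calculus

section Straightening

variable {E : Type u} [NormedAddCommGroup E] [NormedSpace ℝ E]
  {M : Type*} [TopologicalSpace M] [ChartedSpace E M]

theorem exists_openPartialHomeomorph_contDiffOn_symm {F : Type*} [NormedAddCommGroup F]
    [NormedSpace ℝ F] [CompleteSpace E] {f : E → F} {s : Set E} (hs : IsOpen s)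
    (hf : ContDiffOn ℝ ∞ f s) {x : E} (hx : x ∈ s) {f' : E ≃L[ℝ] F}
    (hf' : HasFDerivAt f (f' : E →L[ℝ] F) x) :
    ∃ P : OpenPartialHomeomorph E F, x ∈ P.source ∧ (∀ z, P z = f z) ∧
      ContDiffOn ℝ ∞ P.symm P.target := by
  have hfx (z : E) (hz : z ∈ s) : ContDiffAt ℝ ∞ f z := hf.contDiffAt (hs.mem_nhds hz)
  let t : Set E := s ∩ fderiv ℝ f ⁻¹' range ((↑) : (E ≃L[ℝ] F) → E →L[ℝ] F)
  have ht : IsOpen t := (hf.continuousOn_fderiv_of_isOpen hs (by simp)).isOpen_inter_preimage hs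
    ContinuousLinearEquiv.isOpen
  let P := ((hfx x hx).toOpenPartialHomeomorph f hf' (by simp)).restrOpen t ht
  refine ⟨P, ⟨(hfx x hx).mem_toOpenPartialHomeomorph_source hf' (by simp), hx, f', hf'.fderiv.symm⟩,
    fun z => rfl, fun w hw => ?_⟩
  obtain ⟨hzs, e, he⟩ : P.symm w ∈ t := (P.map_target hw).2
  refine (P.contDiffAt_symm hw (f₀' := e) ?_ (hfx _ hzs)).contDiffWithinAt
  rw [he]
  exact ((hfx _ hzs).differentiableAt (by simp)).hasFDerivAt

theorem hasMFDerivAt_contMDiffMap {F : Type*} [NormedAddCommGroup F] [NormedSpace ℝ F]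
    (f : C^∞⟮𝓘(ℝ, E), M; 𝓘(ℝ, F), F⟯) (q : M) :
    HasMFDerivAt 𝓘(ℝ, E) 𝓘(ℝ, F) f q (mfderiv 𝓘(ℝ, E) 𝓘(ℝ, F) f q) :=
  (f.contMDiff.mdifferentiable (by simp) q).hasMFDerivAt

theorem contMDiffMap_sum_apply {ι : Type*} (s : Finset ι)
    (f : ι → C^∞⟮𝓘(ℝ, E), M; 𝓘(ℝ, ℝ), ℝ⟯) (q : M) : (∑ i ∈ s, f i) q = ∑ i ∈ s, f i q :=
  map_sum (ContMDiffMap.evalRingHom q) f s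

variable [IsManifold 𝓘(ℝ, E) ∞ M]

theorem isLocalDiffeomorphAt_of_hasMFDerivAt [CompleteSpace E]
    {F : Type*} [NormedAddCommGroup F] [NormedSpace ℝ F] {Φ : M → F}
    (hΦ : ContMDiff 𝓘(ℝ, E) 𝓘(ℝ, F) ∞ Φ) {p : M} {Φ' : E ≃L[ℝ] F}
    (hΦ' : HasMFDerivAt 𝓘(ℝ, E) 𝓘(ℝ, F) Φ p (Φ' : E →L[ℝ] F)) :
    IsLocalDiffeomorphAt 𝓘(ℝ, E) 𝓘(ℝ, F) ∞ Φ p := by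
  let φ := chartAt E p
  have hp : p ∈ φ.source := mem_chart_source E p
  have hf : ContDiffOn ℝ ∞ (Φ ∘ φ.symm) φ.target :=
    contMDiffOn_iff_contDiffOn.1 (hΦ.comp_contMDiffOn (contMDiffOn_chart_symm (x := p)))
  have hf' : HasFDerivAt (Φ ∘ φ.symm) (Φ' : E →L[ℝ] F) (φ p) := by
    have h := hΦ'.2
    simp only [writtenInExtChartAt, extChartAt, mfld_simps, chartAt_self_eq] at h
    exact hasFDerivWithinAt_univ.1 h
  obtain ⟨P, hpP, hPf, hP⟩ :=
    exists_openPartialHomeomorph_contDiffOn_symm φ.open_target hf (φ.map_source hp) hf'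
  have hleft (q : M) (hq : q ∈ (φ.trans P).source) : Φ q = φ.trans P q := by
    simp [hPf, φ.left_inv hq.1]
  exact ⟨{
    toPartialEquiv := (φ.trans P).toPartialEquiv
    open_source := (φ.trans P).open_source
    open_target := (φ.trans P).open_target
    contMDiffOn_toFun := hΦ.contMDiffOn.congr fun q hq => (hleft q hq).symm
    contMDiffOn_invFun := (contMDiffOn_chart_symm (x := p)).comp
      (hP.contMDiffOn.mono fun w hw => hw.1) fun w hw => hw.2 }, ⟨hp, hpP⟩, hleft⟩

theorem exists_hasMFDerivAt_id [T2Space M] [FiniteDimensional ℝ E] (p : M) :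
    ∃ χ : C^∞⟮𝓘(ℝ, E), M; 𝓘(ℝ, E), E⟯,
      HasMFDerivAt 𝓘(ℝ, E) 𝓘(ℝ, E) χ p (ContinuousLinearMap.id ℝ E) := by
  let s : SmoothBumpFunction 𝓘(ℝ, E) p := Classical.arbitrary _
  refine ⟨⟨fun q => s q • chartAt E p q, s.contMDiff_smul contMDiffOn_chart⟩, ?_⟩
  have hχ : (fun q => s q • chartAt E p q) =ᶠ[𝓝 p] extChartAt 𝓘(ℝ, E) p := by
    filter_upwards [s.eventuallyEq_one] with q hq
    simp [hq, mfld_simps]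
  refine HasMFDerivAt.congr_of_eventuallyEq ?_ hχ
  have h := (mdifferentiableAt_extChartAt (I := 𝓘(ℝ, E)) (mem_chart_source E p)).hasMFDerivAt
  rwa [mfderiv_extChartAt_self] at h

theorem exists_isLocalDiffeomorphAt_straightening [T2Space M] [FiniteDimensional ℝ E]
    {V : Type*} [NormedAddCommGroup V] [NormedSpace ℝ V] [FiniteDimensional ℝ V]
    (F : C^∞⟮𝓘(ℝ, E), M; 𝓘(ℝ, V), V⟯) {p : M} {F' : E →L[ℝ] V}
    (hF : HasMFDerivAt 𝓘(ℝ, E) 𝓘(ℝ, V) F p F') (hF' : Function.Surjective F') :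
    ∃ Φ : C^∞⟮𝓘(ℝ, E), M; 𝓘(ℝ, E), E⟯, IsLocalDiffeomorphAt 𝓘(ℝ, E) 𝓘(ℝ, E) ∞ Φ p ∧
      ∀ q, F' (Φ q) = F q := by
  obtain ⟨χ, hχ⟩ := exists_hasMFDerivAt_id (E := E) p
  obtain ⟨R, hR⟩ := F'.toLinearMap.exists_rightInverse_of_surjective (LinearMap.range_eq_top.2 hF')
  have hR' (w : V) : F' (R w) = w := LinearMap.congr_fun hR w
  let Rc : V →L[ℝ] E := LinearMap.toContinuousLinearMap R
  have hG : HasMFDerivAt 𝓘(ℝ, E) 𝓘(ℝ, E) (fun q => χ q + Rc (F q - F' (χ q))) p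
      (ContinuousLinearMap.id ℝ E) := by
    have hid : ContinuousLinearMap.id ℝ E + Rc.comp (F' - F'.comp (.id ℝ E)) = .id ℝ E := by simp
    have hFχ := hF.sub (F'.hasMFDerivAt.comp p hχ)
    exact hid ▸ hχ.add (Rc.hasMFDerivAt.comp p hFχ)
  have hsmooth : ContMDiff 𝓘(ℝ, E) 𝓘(ℝ, E) ∞ fun q => χ q + Rc (F q - F' (χ q)) :=
    χ.contMDiff.add (Rc.contMDiff.comp (F.contMDiff.sub (F'.contMDiff.comp χ.contMDiff)))
  refine ⟨⟨_, hsmooth⟩, isLocalDiffeomorphAt_of_hasMFDerivAt hsmooth (Φ' := .refl ℝ E) hG,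
    fun q => ?_⟩
  simp [Rc, hR']

end Straightening

section Division

variable {E : Type u} [NormedAddCommGroup E] [NormedSpace ℝ E]
  {M : Type*} [TopologicalSpace M] [ChartedSpace E M]

theorem map_nhds_eq_of_isLocalDiffeomorphAt {F : Type*} [NormedAddCommGroup F] [NormedSpace ℝ F]
    {Φ : M → F} {p : M} (hΦ : IsLocalDiffeomorphAt 𝓘(ℝ, E) 𝓘(ℝ, F) ∞ Φ p) :
    map Φ (𝓝 p) = 𝓝 (Φ p) := by
  obtain ⟨P, hp, hP⟩ := hΦ
  rw [map_congr (hP.eventuallyEq_of_mem (P.open_source.mem_nhds hp)), hP hp]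
  exact P.toOpenPartialHomeomorph.map_nhds_eq hp

variable [FiniteDimensional ℝ E]

theorem exists_bump [IsManifold 𝓘(ℝ, E) ∞ M] [T2Space M] {p : M} {U : Set M} (hU : U ∈ 𝓝 p) :
    ∃ s : C^∞⟮𝓘(ℝ, E), M; 𝓘(ℝ, ℝ), ℝ⟯, s =ᶠ[𝓝 p] 1 ∧ tsupport s ⊆ U := by
  obtain ⟨s, -, hs⟩ := (SmoothBumpFunction.nhds_basis_tsupport (I := 𝓘(ℝ, E)) p).mem_iff.1 hU
  exact ⟨⟨s, s.contMDiff⟩, s.eventuallyEq_one, hs⟩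

theorem exists_contDiff_factor {Φ : M → E} {p : M}
    (hΦ : IsLocalDiffeomorphAt 𝓘(ℝ, E) 𝓘(ℝ, E) ∞ Φ p) :
    ∃ U ∈ 𝓝 p, ∀ f : C^∞⟮𝓘(ℝ, E), M; 𝓘(ℝ, ℝ), ℝ⟯, ∃ H : E → ℝ, ContDiff ℝ ∞ H ∧
      ∀ q ∈ U, f q = H (Φ q) := by
  obtain ⟨s, hs, hsupp⟩ := exists_bump (E := E)
    (hΦ.localInverse_open_source.mem_nhds hΦ.localInverse_mem_source)
  refine ⟨{q | q ∈ hΦ.localInverse.target ∧ s (Φ q) = 1},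
    inter_mem (hΦ.localInverse.open_target.mem_nhds hΦ.localInverse_mem_target)
      (hΦ.contMDiffAt.continuousAt.eventually hs),
    fun f => ⟨fun z => s z • f (hΦ.localInverse z), ?_, fun q hq => ?_⟩⟩
  · refine (contMDiff_of_tsupport fun z hz => s.contMDiff.contMDiffAt.smul ?_).contDiff
    have hz' := hsupp (tsupport_smul_subset_left _ _ hz)
    exact f.contMDiff.contMDiffAt.comp z
      (hΦ.localInverse_contMDiffOn.contMDiffAt (hΦ.localInverse_open_source.mem_nhds hz'))
  · simp only [hq.2, hΦ.localInverse_left_inv hq.1, one_smul]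

variable [IsManifold 𝓘(ℝ, E) ∞ M] [T2Space M]

theorem exists_eq_mul_of_eq_zero (f : C^∞⟮𝓘(ℝ, E), M; 𝓘(ℝ, ℝ), ℝ⟯) {p : M} (hfp : f p = 0)
    (hf : mfderiv 𝓘(ℝ, E) 𝓘(ℝ, ℝ) f p ≠ 0) {W : Set M} (hW : W ∈ 𝓝 p) :
    ∃ U ∈ 𝓝 p, ∀ d : C^∞⟮𝓘(ℝ, E), M; 𝓘(ℝ, ℝ), ℝ⟯, (∀ q ∈ W, f q = 0 → d q = 0) →
      ∃ g : C^∞⟮𝓘(ℝ, E), M; 𝓘(ℝ, ℝ), ℝ⟯, ∀ q ∈ U, d q = f q * g q := by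
  let l : E →L[ℝ] ℝ := mfderiv 𝓘(ℝ, E) 𝓘(ℝ, ℝ) f p
  have hl : Function.Surjective l := LinearMap.surjective (f := l.toLinearMap)
    fun h => hf (ContinuousLinearMap.coe_injective h)
  obtain ⟨v, hv⟩ := hl 1
  obtain ⟨Φ, hΦ, hlΦ⟩ := exists_isLocalDiffeomorphAt_straightening f
    (F' := l) (hasMFDerivAt_contMDiffMap f p) hl
  obtain ⟨V, hV, hfac⟩ := exists_contDiff_factor hΦ
  have hc : ContDiff ℝ ∞ fun z : E => z - l z • v := by fun_prop
  have hcΦ : ∀ᶠ q in 𝓝 p, Φ q - l (Φ q) • v ∈ Φ '' (V ∩ W) := by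
    refine (hc.continuous.comp Φ.contMDiff.continuous).continuousAt.eventually ?_
    simp only [Function.comp_apply, hlΦ, hfp, zero_smul, sub_zero]
    rw [← map_nhds_eq_of_isLocalDiffeomorphAt hΦ]
    exact image_mem_map (inter_mem hV hW)
  refine ⟨_, inter_mem hV hcΦ, fun d hd => ?_⟩
  obtain ⟨H, hH, hdH⟩ := hfac d
  obtain ⟨L, hL, hHL, -⟩ := exists_contDiff_sub_eq_apply_sub hH hc
  refine ⟨⟨fun q => L (Φ q) v,
    (hL.clm_apply contDiff_const).contMDiff.comp Φ.contMDiff⟩, fun q ⟨hqV, r, hr, hrq⟩ => ?_⟩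
  have hdr : H (Φ q - l (Φ q) • v) = 0 := by
    rw [← hrq, ← hdH r hr.1]
    refine hd r hr.2 ?_
    rw [← hlΦ r, hrq]
    simp [hv]
  have h := hHL (Φ q)
  rw [hdr, sub_zero, sub_sub_cancel, map_smul, hlΦ] at h
  exact (hdH q hqV).trans h

end Division

section VectorFields

variable {E : Type u} [NormedAddCommGroup E] [NormedSpace ℝ E]
  {M : Type*} [TopologicalSpace M] [ChartedSpace E M] [IsManifold 𝓘(ℝ, E) ∞ M]

/-- The derivation `f ↦ df(σ)` of the smooth functions given by a smooth section `σ` of the tangent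
bundle. -/
noncomputable def sectionVField (σ : Cₛ^∞⟮𝓘(ℝ, E); E, (TangentSpace 𝓘(ℝ, E) : M → Type _)⟯) :
    VField C^∞⟮𝓘(ℝ, E), M; 𝓘(ℝ, ℝ), ℝ⟯ :=
  Derivation.mk'
    { toFun := fun f => ⟨fun q => mfderiv 𝓘(ℝ, E) 𝓘(ℝ, ℝ) f q (σ q),
        (contMDiff_snd_tangentBundle_modelSpace ℝ 𝓘(ℝ, ℝ)).comp
          ((f.contMDiff.contMDiff_tangentMap (by simp)).comp σ.contMDiff)⟩
      map_add' := fun f g => by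
        ext q
        exact DFunLike.congr_fun ((hasMFDerivAt_contMDiffMap f q).add
          (hasMFDerivAt_contMDiffMap g q)).mfderiv (σ q)
      map_smul' := fun c f => by
        ext q
        exact DFunLike.congr_fun ((hasMFDerivAt_contMDiffMap f q).const_smul c).mfderiv (σ q) }
    (fun f g => by
      ext q
      exact DFunLike.congr_fun ((hasMFDerivAt_contMDiffMap f q).mul
        (hasMFDerivAt_contMDiffMap g q)).mfderiv (σ q))

variable [FiniteDimensional ℝ E] [T2Space M]

theorem vField_apply_eq_of_eventuallyEq (X : VField C^∞⟮𝓘(ℝ, E), M; 𝓘(ℝ, ℝ), ℝ⟯)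
    {f h : C^∞⟮𝓘(ℝ, E), M; 𝓘(ℝ, ℝ), ℝ⟯} {p : M} (hfh : f =ᶠ[𝓝 p] h) : X f p = X h p := by
  obtain ⟨s, hs, hsupp⟩ := exists_bump (E := E) hfh
  have hzero : s * (f - h) = 0 := by
    ext q
    by_cases hq : f q = h q
    · exact mul_eq_zero_of_right _ (sub_eq_zero.2 hq)
    · exact mul_eq_zero_of_left (image_eq_zero_of_notMem_tsupport fun hq' => hq (hsupp hq')) _
  have hX : s p * (X f p - X h p) + (f p - h p) * X s p = 0 := by
    have hleib := X.leibniz s (f - h)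
    rw [hzero, map_zero, map_sub] at hleib
    exact (DFunLike.congr_fun hleib p).symm
  rw [hs.eq_of_nhds, hfh.eq_of_nhds, sub_self, zero_mul, add_zero] at hX
  exact sub_eq_zero.1 ((one_mul _).symm.trans hX)

theorem exists_vField_apply_eq_mfderiv (p : M) (v : TangentSpace 𝓘(ℝ, E) p) :
    ∃ X : VField C^∞⟮𝓘(ℝ, E), M; 𝓘(ℝ, ℝ), ℝ⟯, ∀ f : C^∞⟮𝓘(ℝ, E), M; 𝓘(ℝ, ℝ), ℝ⟯,
      X f p = mfderiv 𝓘(ℝ, E) 𝓘(ℝ, ℝ) f p v := by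
  obtain ⟨U, hU, hσ⟩ := FiberBundle.exists_contMDiffOn_extend (k := ∞) 𝓘(ℝ, E) E v
  obtain ⟨s, hs, hsupp⟩ := exists_bump (E := E) (interior_mem_nhds.2 hU)
  have hsmooth := ContMDiffOn.smul_section_of_tsupport s.contMDiff.contMDiffOn isOpen_interior hsupp
    (hσ.mono interior_subset)
  refine ⟨sectionVField ⟨fun q => s q • FiberBundle.extend E v q, hsmooth⟩, fun f => ?_⟩
  change mfderiv 𝓘(ℝ, E) 𝓘(ℝ, ℝ) f p (s p • FiberBundle.extend E v p) = _
  rw [hs.eq_of_nhds, FiberBundle.extend_apply_self, Pi.one_apply, one_smul]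

theorem exists_eventuallyEq_add_sum_mul (p : M) {ι : Type*} [Fintype ι]
    (b : Module.Basis ι ℝ E) :
    ∃ x : ι → C^∞⟮𝓘(ℝ, E), M; 𝓘(ℝ, ℝ), ℝ⟯, ∀ f : C^∞⟮𝓘(ℝ, E), M; 𝓘(ℝ, ℝ), ℝ⟯,
      ∃ l : ι → C^∞⟮𝓘(ℝ, E), M; 𝓘(ℝ, ℝ), ℝ⟯,
        f =ᶠ[𝓝 p] (algebraMap ℝ _ (f p) + ∑ i, l i * (x i - algebraMap ℝ _ (x i p)) :
          C^∞⟮𝓘(ℝ, E), M; 𝓘(ℝ, ℝ), ℝ⟯) ∧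
        ∀ i, l i p = mfderiv 𝓘(ℝ, E) 𝓘(ℝ, ℝ) f p (b i) := by
  obtain ⟨χ, hχ⟩ := exists_hasMFDerivAt_id (E := E) p
  obtain ⟨U, hU, hfac⟩ := exists_contDiff_factor
    (isLocalDiffeomorphAt_of_hasMFDerivAt χ.contMDiff (Φ' := .refl ℝ E) hχ)
  let x (i : ι) : C^∞⟮𝓘(ℝ, E), M; 𝓘(ℝ, ℝ), ℝ⟯ := ⟨fun q => b.coord i (χ q),
    (LinearMap.toContinuousLinearMap (b.coord i)).contMDiff.comp χ.contMDiff⟩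
  refine ⟨x, fun f => ?_⟩
  obtain ⟨H, hH, hfH⟩ := hfac f
  obtain ⟨L, hL, hHL, hLp⟩ := exists_contDiff_sub_eq_apply_sub hH (contDiff_const (c := χ p))
  let l (i : ι) : C^∞⟮𝓘(ℝ, E), M; 𝓘(ℝ, ℝ), ℝ⟯ := ⟨fun q => L (χ q) (b i),
    (hL.clm_apply contDiff_const).contMDiff.comp χ.contMDiff⟩
  refine ⟨l, ?_, fun i => ?_⟩
  · filter_upwards [hU] with q hq
    have hLq : L (χ q) (χ q - χ p) = ∑ i, l i q * (x i q - x i p) := by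
      conv_lhs => rw [← b.sum_repr (χ q - χ p)]
      simp only [map_sum, map_smul, map_sub, Finsupp.sub_apply, smul_eq_mul, mul_comm,
        l, x, ContMDiffMap.coeFn_mk, Module.Basis.coord_apply]
    calc f q = H (χ p) + L (χ q) (χ q - χ p) := by rw [hfH q hq, ← hHL (χ q), add_sub_cancel]
      _ = f p + ∑ i, l i q * (x i q - x i p) := by
        rw [hLq, hfH p (mem_of_mem_nhds hU)]
      _ = _ := congrArg (f p + ·) (contMDiffMap_sum_apply _
        (fun i => l i * (x i - algebraMap ℝ _ (x i p))) q).symm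
  · have hf := ((hH.differentiable (by simp) (χ p)).hasFDerivAt.hasMFDerivAt.comp p
      hχ).congr_of_eventuallyEq (mem_of_superset hU hfH)
    exact DFunLike.congr_fun ((hLp _ rfl).trans hf.mfderiv.symm) (b i)

theorem exists_mfderiv_eq_vField_apply (X : VField C^∞⟮𝓘(ℝ, E), M; 𝓘(ℝ, ℝ), ℝ⟯) (p : M) :
    ∃ v : TangentSpace 𝓘(ℝ, E) p, ∀ f : C^∞⟮𝓘(ℝ, E), M; 𝓘(ℝ, ℝ), ℝ⟯,
      X f p = mfderiv 𝓘(ℝ, E) 𝓘(ℝ, ℝ) f p v := by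
  let b := Module.finBasis ℝ E
  obtain ⟨x, hx⟩ := exists_eventuallyEq_add_sum_mul p b
  refine ⟨∑ i, X (x i) p • b i, fun f => ?_⟩
  obtain ⟨l, hf, hl⟩ := hx f
  rw [vField_apply_eq_of_eventuallyEq X hf]
  simp only [map_add, Derivation.map_algebraMap, zero_add, map_sum, Derivation.leibniz, map_sub,
    sub_zero, contMDiffMap_sum_apply]
  let df : E →L[ℝ] ℝ := mfderiv 𝓘(ℝ, E) 𝓘(ℝ, ℝ) f p
  change _ = df (∑ i, X (x i) p • b i)
  rw [map_sum]
  refine Finset.sum_congr rfl fun i _ => ?_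
  rw [map_smul]
  have hli : df (b i) = l i p := (hl i).symm
  change l i p * X (x i) p + (x i p - x i p) * X (l i) p = X (x i) p * df (b i)
  rw [hli, sub_self, zero_mul, add_zero, mul_comm]

end VectorFields

section Equations

variable {E : Type u} [NormedAddCommGroup E] [NormedSpace ℝ E]
  {M : Type*} [TopologicalSpace M] [ChartedSpace E M]

local notation "𝒪" => C^∞⟮𝓘(ℝ, E), M; 𝓘(ℝ, ℝ), ℝ⟯

/-- `f` is an equation of the set `Z` near `p`: it vanishes on `Z` and generates the ideal of `Z` in
the ring of germs at `p`. Germs are encoded by multiplication with a function `s` not vanishing at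
`p`, the same `s` for the whole ideal. -/
def IsEquationAt (Z : Set M) (f : 𝒪) (p : M) : Prop :=
  (∀ q ∈ Z, f q = 0) ∧ ∃ s : 𝒪, s p ≠ 0 ∧ ∀ d : 𝒪, (∀ q ∈ Z, d q = 0) → f ∣ s * d

/-- `f` is not a zero divisor among the germs at `p` of functions on `W`. -/
def IsRegularAt (W : Set M) (f : 𝒪) (p : M) : Prop :=
  ∃ b : 𝒪, b p ≠ 0 ∧ ∀ e : 𝒪, (∀ q ∈ W, f q * e q = 0) → ∀ q ∈ W, b q * e q = 0

theorem isRegularAt_of_ne_zero (W : Set M) {f : 𝒪} {p : M} (hf : f p ≠ 0) : IsRegularAt W f p :=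
  ⟨f, hf, fun _ he => he⟩

theorem IsRegularAt.mul {W : Set M} {f g : 𝒪} {p : M} (hf : IsRegularAt W f p)
    (hg : IsRegularAt W g p) : IsRegularAt W (f * g) p := by
  obtain ⟨a, hap, ha⟩ := hf
  obtain ⟨b, hbp, hb⟩ := hg
  refine ⟨b * a, mul_ne_zero hbp hap, fun e he q hq => ?_⟩
  have hge : ∀ q ∈ W, a q * (g q * e q) = 0 :=
    ha (g * e) fun q hq => (mul_assoc (f q) (g q) (e q)).symm.trans (he q hq)
  exact (mul_assoc (b q) (a q) (e q)).trans
    (hb (a * e) (fun q hq => (mul_left_comm (g q) (a q) (e q)).trans (hge q hq)) q hq)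

theorem IsEquationAt.union {Z W : Set M} {f g : 𝒪} {p : M} (hf : IsEquationAt Z f p)
    (hg : IsEquationAt W g p) (hfW : IsRegularAt W f p) : IsEquationAt (Z ∪ W) (f * g) p := by
  obtain ⟨hfZ, s, hsp, hs⟩ := hf
  obtain ⟨hgW, t, htp, ht⟩ := hg
  obtain ⟨b, hbp, hb⟩ := hfW
  refine ⟨fun q hq => ?_, t * b * s, mul_ne_zero (mul_ne_zero htp hbp) hsp, fun d hd => ?_⟩
  · exact hq.elim (fun hq => mul_eq_zero_of_left (hfZ q hq) _)
      fun hq => mul_eq_zero_of_right _ (hgW q hq)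
  obtain ⟨e, he⟩ := hs d fun q hq => hd q (.inl hq)
  have hfe : ∀ q ∈ W, f q * e q = 0 := fun q hq =>
    (DFunLike.congr_fun he q).symm.trans (mul_eq_zero_of_right _ (hd q (.inr hq)))
  obtain ⟨h, hh⟩ := ht (b * e) (hb e hfe)
  exact ⟨h, by linear_combination t * b * he + f * hh⟩

theorem isEquationAt_biUnion {ι : Type*} {Z : ι → Set M} {f : ι → 𝒪} {p : M}
    (hf : ∀ i, IsEquationAt (Z i) (f i) p) (hreg : ∀ i j, i ≠ j → IsRegularAt (Z j) (f i) p)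
    (s : Finset ι) : IsEquationAt (⋃ i ∈ s, Z i) (∏ i ∈ s, f i) p := by
  classical
  induction s using Finset.induction_on with
  | empty => exact ⟨by simp, 1, one_ne_zero, fun d _ => by simp⟩
  | insert j s hj ih =>
    rw [Finset.set_biUnion_insert, Finset.prod_insert hj, union_comm, mul_comm]
    refine ih.union (hf j) (Finset.prod_induction f (IsRegularAt (Z j) · p) (fun _ _ => .mul)
      (isRegularAt_of_ne_zero _ one_ne_zero) fun i hi => hreg i j ?_)
    rintro rfl
    exact hj hi

/-- `f` is a defining function of the hypersurface `Z` near `p`. The point `p` need not lie on `Z`,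
in which case `f p ≠ 0`. -/
structure IsDefiningAt (Z : Set M) (f : 𝒪) (p : M) : Prop where
  eq_zero : ∀ q ∈ Z, f q = 0
  eventually_mem : ∀ᶠ q in 𝓝 p, f q = 0 → q ∈ Z
  mfderiv_ne_zero : f p = 0 → mfderiv 𝓘(ℝ, E) 𝓘(ℝ, ℝ) f p ≠ 0

variable [FiniteDimensional ℝ E] [IsManifold 𝓘(ℝ, E) ∞ M] [T2Space M]

theorem IsDefiningAt.isEquationAt {Z : Set M} {f : 𝒪} {p : M} (hf : IsDefiningAt Z f p) :
    IsEquationAt Z f p := by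
  refine ⟨hf.eq_zero, ?_⟩
  by_cases hfp : f p = 0
  · obtain ⟨U, hU, hdvd⟩ := exists_eq_mul_of_eq_zero f hfp (hf.mfderiv_ne_zero hfp)
      hf.eventually_mem
    obtain ⟨s, hs, hsU⟩ := exists_bump (E := E) hU
    refine ⟨s, by simp [hs.eq_of_nhds], fun d hd => ?_⟩
    obtain ⟨g, hg⟩ := hdvd d fun q hq hfq => hd q (hq hfq)
    refine ⟨s * g, ?_⟩
    ext q
    change s q * d q = f q * (s q * g q)
    by_cases hq : q ∈ U
    · rw [hg q hq, mul_left_comm]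
    · simp only [image_eq_zero_of_notMem_tsupport fun h => hq (hsU h), zero_mul, mul_zero]
  · exact ⟨f, hfp, fun d _ => dvd_mul_right f d⟩

theorem eventually_mem_closure_of_surjective (f g : 𝒪) {p : M} {df dg : E →L[ℝ] ℝ}
    (hf : HasMFDerivAt 𝓘(ℝ, E) 𝓘(ℝ, ℝ) f p df) (hg : HasMFDerivAt 𝓘(ℝ, E) 𝓘(ℝ, ℝ) g p dg)
    (hfg : Function.Surjective (df.prod dg)) :
    ∀ᶠ q in 𝓝 p, f q = 0 → q ∈ closure {r | f r = 0 ∧ g r ≠ 0} := by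
  have hF : HasMFDerivAt 𝓘(ℝ, E) 𝓘(ℝ, ℝ × ℝ) (fun q => (f q, g q)) p (df.prod dg) :=
    ⟨hf.1.prodMk hg.1, hf.2.prodMk hg.2⟩
  obtain ⟨Φ, ⟨P, hpP, hP⟩, hΦ⟩ := exists_isLocalDiffeomorphAt_straightening
    ⟨_, f.contMDiff.prodMk_space g.contMDiff⟩ hF hfg
  have hΦf (r : M) : df (Φ r) = f r := congrArg Prod.fst (hΦ r)
  have hΦg (r : M) : dg (Φ r) = g r := congrArg Prod.snd (hΦ r)
  obtain ⟨v, hv⟩ := hfg (0, 1)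
  obtain ⟨hfv, hgv⟩ : df v = 0 ∧ dg v = 1 := Prod.mk.inj hv
  filter_upwards [P.open_source.mem_nhds hpP] with q hq hfq
  by_cases hgq : g q = 0
  · have hline : Tendsto (fun t : ℝ => Φ q + t • v) (𝓝[≠] 0) (map Φ (𝓝 q)) := by
      rw [map_nhds_eq_of_isLocalDiffeomorphAt ⟨P, hq, hP⟩]
      exact tendsto_nhdsWithin_of_tendsto_nhds (Continuous.tendsto' (by fun_prop) _ _ (by simp))
    have hfreq : ∃ᶠ z in map Φ (𝓝 q), df z = 0 ∧ dg z ≠ 0 :=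
      hline.frequently <| Eventually.frequently <| eventually_mem_nhdsWithin.mono fun t ht => by
        simpa [hΦf, hΦg, hfv, hgv, hfq, hgq] using ht
    simpa only [mem_closure_iff_frequently, mem_ofPred_eq, frequently_map, hΦf, hΦg] using hfreq
  · exact subset_closure ⟨hfq, hgq⟩

/-- Near `p` the points of `W` off the zero set of `f` are dense in `W`, so that there a multiple of
`f` vanishes on `W` only if the cofactor does. -/
theorem isRegularAt_of_surjective {W : Set M} {f g : 𝒪} {p : M} {df dg : E →L[ℝ] ℝ}
    (hf : HasMFDerivAt 𝓘(ℝ, E) 𝓘(ℝ, ℝ) f p df) (hg : HasMFDerivAt 𝓘(ℝ, E) 𝓘(ℝ, ℝ) g p dg)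
    (hgW : IsDefiningAt W g p) (hgf : Function.Surjective (dg.prod df)) : IsRegularAt W f p := by
  have hmem := hgW.eventually_mem.eventually_nhds.and
    (eventually_mem_closure_of_surjective g f hg hf hgf)
  obtain ⟨b, hb, hbsupp⟩ := exists_bump (E := E) hmem
  refine ⟨b, by simp [hb.eq_of_nhds], fun e he q hq => ?_⟩
  by_cases hbq : q ∈ tsupport b
  · obtain ⟨hW, hcl⟩ := hbsupp hbq
    have he0 : e q = 0 := by
      refine isClosed_singleton.mem_of_frequently_of_tendsto ?_
        e.contMDiff.continuous.continuousAt
      refine ((mem_closure_iff_frequently.1 (hcl (hgW.eq_zero q hq))).and_eventually hW).mono ?_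
      exact fun r ⟨⟨hgr, hfr⟩, hr⟩ => (mul_eq_zero.1 (he r (hr hgr))).resolve_left hfr
    exact mul_eq_zero_of_right _ he0
  · exact mul_eq_zero_of_left (image_eq_zero_of_notMem_tsupport hbq) _

end Equations

section Gluing

variable {E : Type u} [NormedAddCommGroup E] [NormedSpace ℝ E]
  {M : Type*} [TopologicalSpace M] [ChartedSpace E M]

local notation "𝒪" => C^∞⟮𝓘(ℝ, E), M; 𝓘(ℝ, ℝ), ℝ⟯

theorem isLeftRegular_of_dense {ρ : 𝒪} (hρ : Dense {q | ρ q ≠ 0}) : IsLeftRegular ρ := by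
  intro f g (hfg : ρ * f = ρ * g)
  refine DFunLike.coe_injective (Continuous.ext_on hρ f.contMDiff.continuous
    g.contMDiff.continuous fun q hq => ?_)
  exact mul_left_cancel₀ hq (DFunLike.congr_fun hfg q)

theorem dvd_of_forall_exists_dvd_mul {ρ f : 𝒪} (hρ : IsLeftRegular ρ)
    (h : ∀ p, ∃ s : 𝒪, s p ≠ 0 ∧ ρ ∣ s * f) : ρ ∣ f := by
  choose s hs g hg using h
  have hsg (p q : M) : s p * g q = s q * g p :=
    hρ (show ρ * (s p * g q) = ρ * (s q * g p) by linear_combination s q * hg p - s p * hg q)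
  have hsmooth : ContMDiff 𝓘(ℝ, E) 𝓘(ℝ, ℝ) ∞ fun q => g q q / s q q := fun p => by
    refine (((g p).contMDiff p).div₀ ((s p).contMDiff p) (hs p)).congr_of_eventuallyEq ?_
    filter_upwards [(s p).contMDiff.continuous.continuousAt.eventually_ne (hs p)] with q hq
    rw [Pi.div_apply, div_eq_div_iff (hs q) hq, mul_comm, mul_comm (g p q)]
    exact DFunLike.congr_fun (hsg p q) q
  refine ⟨⟨_, hsmooth⟩, ?_⟩
  ext q
  change f q = ρ q * (g q q / s q q)
  have hgq : s q q * f q = ρ q * g q q := DFunLike.congr_fun (hg q) q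
  rw [mul_div_assoc', ← hgq, mul_div_cancel_left₀ _ (hs q)]

theorem exists_linearMap_mul_eq {R M : Type*} [CommSemiring R] [AddCommMonoid M] [Module R M]
    {ρ : R} (hρ : IsLeftRegular ρ) (k : M →ₗ[R] R) (h : ∀ m, ρ ∣ k m) :
    ∃ l : M →ₗ[R] R, ∀ m, ρ * l m = k m := by
  choose l hl using h
  refine ⟨⟨⟨l, fun m m' => hρ ?_⟩, fun r m => hρ ?_⟩, fun m => (hl m).symm⟩
  · change ρ * l (m + m') = ρ * (l m + l m')
    rw [mul_add, ← hl, ← hl, ← hl, map_add]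
  · change ρ * l (r • m) = ρ * (r • l m)
    rw [mul_smul_comm, ← hl, ← hl, map_smul]

theorem IsDefiningAt.mem_closure {Z : Set M} {f : 𝒪} {p : M} (hf : IsDefiningAt Z f p) :
    p ∈ closure {q | f q ≠ 0} := by
  rw [mem_closure_iff_frequently]
  by_contra h
  have hf0 : f =ᶠ[𝓝 p] fun _ => 0 := (not_frequently.1 h).mono fun q hq => not_not.1 hq
  exact hf.mfderiv_ne_zero hf0.eq_of_nhds (hf0.mfderiv_eq.trans mfderiv_const)

end Gluing

section Divisor

variable {S : Type*} [TopologicalSpace S] [ChartedSpace (EuclideanSpace ℝ (Fin 2)) S]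
  [T2Space S] [IsManifold (𝓡 2) ∞ S]

theorem IsSmoothClosedCurve.exists_isDefiningAt {Z : Set S} (hZ : IsSmoothClosedCurve Z) (p : S) :
    ∃ f : Smooth S, IsDefiningAt Z f p := by
  by_cases hp : p ∈ Z
  · obtain ⟨g, hg, hgZ⟩ := hZ.2 p hp
    obtain ⟨s, hs, hsupp⟩ := exists_bump (E := EuclideanSpace ℝ (Fin 2)) hgZ
    have hsg : (s * g : Smooth S) =ᶠ[𝓝 p] g := hs.mono fun q hq => by
      change s q * g q = g q
      rw [hq, Pi.one_apply, one_mul]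
    refine ⟨s * g, fun q hq => ?_, ?_, fun _ => ?_⟩
    · by_cases hqs : q ∈ tsupport s
      · exact mul_eq_zero_of_right _ ((hsupp hqs).1 hq)
      · exact mul_eq_zero_of_left (image_eq_zero_of_notMem_tsupport hqs) _
    · filter_upwards [hsg, hgZ] with q hq hqZ hq0
      exact hqZ.2 (hq.symm.trans hq0)
    · exact fun h => hg (hsg.mfderiv_eq.symm.trans h)
  · obtain ⟨s, hs, hsupp⟩ := exists_bump (E := EuclideanSpace ℝ (Fin 2))
      (hZ.1.isOpen_compl.mem_nhds hp)
    have hsne : ∀ᶠ q in 𝓝 p, s q ≠ 0 := hs.mono fun q hq => by simp [hq]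
    exact ⟨s, fun q hq => image_eq_zero_of_notMem_tsupport fun hqs => hsupp hqs hq,
      hsne.mono fun q hq h => absurd h hq, fun h => absurd h hsne.self_of_nhds⟩

variable {n : ℕ} {D : Fin n → Set S}

theorem IsStarDivisor.isRegularAt (hD : IsStarDivisor D) {i j : Fin n} (hij : i ≠ j)
    {f g : Smooth S} {p : S} (hf : IsDefiningAt (D i) f p) (hg : IsDefiningAt (D j) g p) :
    IsRegularAt (D j) f p := by
  by_cases hfp : f p = 0
  swap
  · exact isRegularAt_of_ne_zero _ hfp
  by_cases hgp : g p = 0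
  swap
  · exact ⟨g, hgp, fun e _ q hq => mul_eq_zero_of_left (hg.eq_zero q hq) _⟩
  let df : EuclideanSpace ℝ (Fin 2) →L[ℝ] ℝ := mfderiv (𝓡 2) 𝓘(ℝ, ℝ) f p
  let dg : EuclideanSpace ℝ (Fin 2) →L[ℝ] ℝ := mfderiv (𝓡 2) 𝓘(ℝ, ℝ) g p
  have hsup : dg.toLinearMap.ker ⊔ df.toLinearMap.ker = ⊤ := by
    refine top_unique ((hD.transverse j i hij.symm p ⟨hg.eventually_mem.self_of_nhds hgp,
      hf.eventually_mem.self_of_nhds hfp⟩).ge.trans (sup_le_sup ?_ ?_))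
    · exact iInf₂_le g hg.eq_zero
    · exact iInf₂_le f hf.eq_zero
  have hrange (l : EuclideanSpace ℝ (Fin 2) →L[ℝ] ℝ) (hl : l ≠ 0) : l.toLinearMap.range = ⊤ :=
    LinearMap.range_eq_top.2 <|
      LinearMap.surjective fun h => hl (ContinuousLinearMap.coe_injective h)
  refine isRegularAt_of_surjective (hasMFDerivAt_contMDiffMap f p) (hasMFDerivAt_contMDiffMap g p)
    hg ((LinearMap.range_eq_top (f := dg.toLinearMap.prod df.toLinearMap)).1 ?_)
  rw [LinearMap.range_prod_eq hsup, hrange dg (hg.mfderiv_ne_zero hgp),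
    hrange df (hf.mfderiv_ne_zero hfp), Submodule.prod_top]

theorem IsStarDivisor.exists_isEquationAt_prod (hD : IsStarDivisor D) (p : S) :
    ∃ f : Fin n → Smooth S, (∀ i, IsDefiningAt (D i) (f i) p) ∧
      IsEquationAt (⋃ i, D i) (∏ i, f i) p := by
  choose f hf using fun i => (hD.curve i).exists_isDefiningAt p
  refine ⟨f, hf, ?_⟩
  simpa only [Finset.mem_univ, iUnion_true] using isEquationAt_biUnion
    (fun i => (hf i).isEquationAt) (fun i j hij => hD.isRegularAt hij (hf i) (hf j)) Finset.univ

theorem IsStarDivisor.dense_compl (hD : IsStarDivisor D) : Dense (⋃ i, D i)ᶜ := by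
  have : LocallyCompactSpace S := ChartedSpace.locallyCompactSpace (EuclideanSpace ℝ (Fin 2)) S
  rw [compl_iUnion]
  refine dense_iInter_of_isOpen (fun i => (hD.curve i).1.isOpen_compl) fun i p => ?_
  obtain ⟨f, hf⟩ := (hD.curve i).exists_isDefiningAt p
  exact closure_mono (fun q (hq : f q ≠ 0) hqi => hq (hf.eq_zero q hqi)) hf.mem_closure

theorem IsStarDivisor.exists_isLeftRegular [SecondCountableTopology S] (hD : IsStarDivisor D) :
    ∃ ρ : Smooth S, (∀ q ∈ ⋃ i, D i, ρ q = 0) ∧ IsLeftRegular ρ := by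
  have : LocallyCompactSpace S := ChartedSpace.locallyCompactSpace (EuclideanSpace ℝ (Fin 2)) S
  have hopen : IsOpen (⋃ i, D i)ᶜ :=
    (isClosed_iUnion_of_finite fun i => (hD.curve i).1).isOpen_compl
  obtain ⟨ρ, hsupp, hρ, -⟩ := hopen.exists_contMDiff_support_eq (n := ⊤) (𝓡 2)
  refine ⟨⟨ρ, hρ⟩, fun q hq => ?_, isLeftRegular_of_dense ?_⟩
  · exact Function.notMem_support.1 (hsupp ▸ fun h => h hq)
  · exact hD.dense_compl.mono hsupp.ge

end Divisor

section Frame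

variable {S : Type*} [TopologicalSpace S] [ChartedSpace (EuclideanSpace ℝ (Fin 2)) S]

/-- The Jacobian determinant `(dx ∧ dy)(X, Y)` of the functions `x` and `y` along the vector fields
`X` and `Y`. -/
noncomputable def jac (x y : Smooth S) (X Y : VField (Smooth S)) : Smooth S :=
  X x * Y y - X y * Y x

theorem jac_smul_right (x y f : Smooth S) (X Y : VField (Smooth S)) :
    jac x y X (f • Y) = f * jac x y X Y := by
  simp only [jac, Derivation.smul_apply, smul_eq_mul]
  ring

variable [T2Space S] [IsManifold (𝓡 2) ∞ S]

theorem jac_smul_eq_add (x y : Smooth S) (X Y U : VField (Smooth S)) :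
    jac x y X Y • U = jac x y U Y • X + jac x y X U • Y := by
  ext f p
  let d (g : Smooth S) : EuclideanSpace ℝ (Fin 2) →L[ℝ] ℝ := mfderiv (𝓡 2) 𝓘(ℝ, ℝ) g p
  have hd (g : Smooth S) (v : EuclideanSpace ℝ (Fin 2)) : d g v =
      v 0 * d g (EuclideanSpace.single 0 1) + v 1 * d g (EuclideanSpace.single 1 1) := by
    conv_lhs => rw [← (EuclideanSpace.basisFun (Fin 2) ℝ).sum_repr v]
    simp [Fin.sum_univ_two]
  have hcoord (V : VField (Smooth S)) : ∃ v : EuclideanSpace ℝ (Fin 2), ∀ g : Smooth S, V g p =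
      v 0 * d g (EuclideanSpace.single 0 1) + v 1 * d g (EuclideanSpace.single 1 1) := by
    obtain ⟨v, hv⟩ := exists_mfderiv_eq_vField_apply V p
    exact ⟨v, fun g => (hv g).trans (hd g v)⟩
  obtain ⟨a, ha⟩ := hcoord X
  obtain ⟨b, hb⟩ := hcoord Y
  obtain ⟨c, hc⟩ := hcoord U
  change (X x p * Y y p - X y p * Y x p) * U f p =
    (U x p * Y y p - U y p * Y x p) * X f p + (X x p * U y p - X y p * U x p) * Y f p
  simp only [ha, hb, hc]
  ring

theorem exists_vField_apply_ne_zero {f : Smooth S} {p : S}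
    (hf : mfderiv (𝓡 2) 𝓘(ℝ, ℝ) f p ≠ 0) : ∃ X : VField (Smooth S), X f p ≠ 0 := by
  obtain ⟨v, hv⟩ := DFunLike.ne_iff.1 hf
  obtain ⟨X, hX⟩ := exists_vField_apply_eq_mfderiv p v
  exact ⟨X, (hX f).trans_ne hv⟩

theorem exists_jac_ne_zero (p : S) :
    ∃ (x y : Smooth S) (X Y : VField (Smooth S)), jac x y X Y p ≠ 0 := by
  obtain ⟨χ, hχ⟩ := exists_hasMFDerivAt_id (E := EuclideanSpace ℝ (Fin 2)) p
  let x (i : Fin 2) : Smooth S :=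
    ⟨fun q => χ q i, (EuclideanSpace.proj i).contMDiff.comp χ.contMDiff⟩
  have hx (i : Fin 2) : HasMFDerivAt (𝓡 2) 𝓘(ℝ, ℝ) (x i) p (EuclideanSpace.proj (𝕜 := ℝ) i) :=
    (EuclideanSpace.proj (𝕜 := ℝ) i).hasMFDerivAt.comp p hχ
  choose X hX using fun j : Fin 2 =>
    exists_vField_apply_eq_mfderiv p (EuclideanSpace.single j (1 : ℝ))
  have hXx (i j : Fin 2) : X j (x i) p = if i = j then 1 else 0 :=
    (hX j (x i)).trans ((DFunLike.congr_fun (hx i).mfderiv _).trans (PiLp.single_apply 2 ℝ j 1 i))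
  refine ⟨x 0, x 1, X 0, X 1, ?_⟩
  change X 0 (x 0) p * X 1 (x 1) p - X 0 (x 1) p * X 1 (x 0) p ≠ 0
  norm_num [hXx]

end Frame

section BTwoForm

variable {R A : Type*} [CommRing R] [AddCommGroup A] [Module R A]

theorem twoForm_swap (Ω : A [⋀^Fin 2]→ₗ[R] R) (u v : A) : Ω ![v, u] = -Ω ![u, v] := by
  have hperm : ![u, v] ∘ Equiv.swap (0 : Fin 2) 1 = ![v, u] := by
    ext i : 1
    fin_cases i <;> rfl
  exact hperm ▸ Ω.map_swap ![u, v] (i := 0) (j := 1) zero_ne_one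

/-- The contraction `u ↦ Ω(u, ·)` of an alternating two-form. -/
def flat (Ω : A [⋀^Fin 2]→ₗ[R] R) : A →ₗ[R] Module.Dual R A :=
  LinearMap.mk₂ R (fun u v => Ω ![u, v]) (fun u u' v => Ω.map_vecCons_add ![v] u u')
    (fun r u v => Ω.map_vecCons_smul ![v] r u)
    (fun u v v' => by simp only [twoForm_swap Ω _ u, Ω.map_vecCons_add, neg_add])
    (fun r u v => by simp only [twoForm_swap Ω _ u, Ω.map_vecCons_smul, smul_neg])

theorem flat_apply (Ω : A [⋀^Fin 2]→ₗ[R] R) (u v : A) : flat Ω u v = Ω ![u, v] := rfl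

theorem flat_swap (Ω : A [⋀^Fin 2]→ₗ[R] R) (u v : A) : flat Ω v u = -flat Ω u v :=
  twoForm_swap Ω u v

theorem flat_self (Ω : A [⋀^Fin 2]→ₗ[R] R) (u : A) : flat Ω u u = 0 :=
  Ω.map_eq_zero_of_eq ![u, u] (i := 0) (j := 1) rfl zero_ne_one

end BTwoForm

section Rigged

variable {S : Type*} [TopologicalSpace S] [ChartedSpace (EuclideanSpace ℝ (Fin 2)) S]
  {n : ℕ} {D : Fin n → Set S}

theorem zeroFields_le_bFields : zeroFields D ≤ bFields D :=
  fun _ hX i f _ q hq => hX i q hq f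

theorem smul_mem_zeroFields {ρ : Smooth S} (hρ : ∀ q ∈ ⋃ i, D i, ρ q = 0)
    (X : VField (Smooth S)) : ρ • X ∈ zeroFields D :=
  fun i q hq _ => mul_eq_zero_of_left (hρ q (mem_iUnion_of_mem i hq)) _

/-- The multiplication `X ↦ ρ X` by a function `ρ` that vanishes on the divisor, which takes
arbitrary vector fields to sections of the `b`-tangent bundle. -/
noncomputable def smulField (ρ : Smooth S) (hρ : ∀ q ∈ ⋃ i, D i, ρ q = 0) :
    VField (Smooth S) →ₗ[Smooth S] bFields D :=
  (LinearMap.lsmul (Smooth S) (VField (Smooth S)) ρ).codRestrict (bFields D)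
    fun X => zeroFields_le_bFields (smul_mem_zeroFields hρ X)

theorem smulField_coe {ρ : Smooth S} (hρ : ∀ q ∈ ⋃ i, D i, ρ q = 0) (u : bFields D) :
    smulField ρ hρ u = ρ • u := rfl

theorem mul_flat_smulField (Ω : BTwoForm D) {ρ κ s F : Smooth S} (hρ : ∀ q ∈ ⋃ i, D i, ρ q = 0)
    (hF : ∀ q ∈ ⋃ i, D i, F q = 0) (h : s * ρ = F * κ) (u : bFields D) (X : VField (Smooth S)) :
    s * flat Ω u (smulField ρ hρ X) = κ * flat Ω u (smulField F hF X) := by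
  have hX : s • smulField ρ hρ X = κ • smulField F hF X := by
    ext1
    change s • ρ • X = κ • F • X
    rw [smul_smul, smul_smul, h, mul_comm]
  simpa only [map_smul, smul_eq_mul] using congrArg (flat Ω u) hX

theorem IsStarLogSymplectic.bijective_flat {Ω : BTwoForm D} (hΩ : IsStarLogSymplectic D Ω) :
    Function.Bijective (flat (R := Smooth S) (A := bFields D) Ω) := by
  refine (Function.bijective_iff_existsUnique _).2 fun α => ?_
  simpa only [LinearMap.ext_iff, flat_apply] using hΩ.nondegenerate α

theorem exists_smul_mem_bFields {i : Fin n} {f G : Smooth S} {p : S} (hf : IsEquationAt (D i) f p)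
    (hG : ∀ j ≠ i, ∀ q ∈ D j, G q = 0) {K : VField (Smooth S)} (hK : K f = 0) :
    ∃ s : Smooth S, s p ≠ 0 ∧ (s * G) • K ∈ bFields D := by
  obtain ⟨hfD, s, hsp, hs⟩ := hf
  refine ⟨s, hsp, fun j h hh q hq => ?_⟩
  change s q * G q * K h q = 0
  obtain rfl | hj := eq_or_ne j i
  · obtain ⟨e, he⟩ := hs h hh
    have hKh : s q * K h q + h q * K s q = f q * K e q := by
      have hleib := congrArg K he
      simp only [Derivation.leibniz, hK, smul_zero, add_zero] at hleib
      exact DFunLike.congr_fun hleib q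
    rw [hh q hq, hfD q hq, zero_mul, zero_mul, add_zero] at hKh
    rw [mul_right_comm, hKh, zero_mul]
  · rw [hG j hj q hq, mul_zero, zero_mul]

variable [T2Space S] [IsManifold (𝓡 2) ∞ S]

theorem flat_mul_jac (Ω : BTwoForm D) (x y : Smooth S) (a b c d : bFields D) :
    flat Ω a b * jac x y c d = flat Ω c d * jac x y a b := by
  have hcramer (a b c : bFields D) : jac x y a b • c = jac x y c b • a + jac x y a c • b :=
    Subtype.ext (jac_smul_eq_add x y a b c)
  have hplucker (a b c d : bFields D) : jac x y a b * jac x y c d =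
      jac x y c b * jac x y a d - jac x y a c * jac x y d b := by
    simp only [jac]
    ring
  have key (a b c d : bFields D) :
      jac x y a b * (flat Ω a b * jac x y c d - flat Ω c d * jac x y a b) = 0 := by
    have hc := DFunLike.congr_fun (congrArg (flat Ω) (hcramer a b c)) d
    have hda := congrArg (flat Ω a) (hcramer a b d)
    have hdb := congrArg (flat Ω b) (hcramer a b d)
    simp only [map_add, map_smul, LinearMap.add_apply, LinearMap.smul_apply, smul_eq_mul,
      flat_self, flat_swap Ω a b] at hc hda hdb
    linear_combination flat Ω a b * hplucker a b c d - jac x y a b * hc - jac x y c b * hda -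
      jac x y a c * hdb
  have hsq : (flat Ω a b * jac x y c d - flat Ω c d * jac x y a b) ^ 2 = 0 := by
    linear_combination -flat Ω c d * key a b c d - flat Ω a b * key c d a b
  ext p
  exact sub_eq_zero.1 (pow_eq_zero_iff two_ne_zero |>.1 (DFunLike.congr_fun hsq p))

theorem exists_mul_apply_eq (hD : IsStarDivisor D) [SecondCountableTopology S] {i : Fin n}
    {f : Smooth S} {p : S} (hf : IsDefiningAt (D i) f p) :
    ∃ (l : Module.Dual (Smooth S) (bFields D)) (c : Smooth S), c p ≠ 0 ∧
      ∀ v : bFields D, f * l v = c * (v : VField (Smooth S)) f := by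
  obtain ⟨ρ, hρD, hρ⟩ := hD.exists_isLeftRegular
  obtain ⟨hfD, s, hsp, hs⟩ := hf.isEquationAt
  obtain ⟨κ, hκ⟩ := hs ρ fun q hq => hρD q (mem_iUnion_of_mem i hq)
  obtain ⟨l, hl⟩ := exists_linearMap_mul_eq hρ ((s * κ) • dFun f ∘ₗ (bFields D).subtype)
    fun v => by
      obtain ⟨e, he⟩ := hs _ (v.2 i f hfD)
      refine ⟨s * e, ?_⟩
      change s * κ * (v : VField (Smooth S)) f = ρ * (s * e)
      linear_combination κ * he - e * hκ
  refine ⟨l, s * s, mul_ne_zero hsp hsp, fun v => hρ ?_⟩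
  have hlv : ρ * l v = s * κ * (v : VField (Smooth S)) f := hl v
  change ρ * (f * l v) = ρ * (s * s * (v : VField (Smooth S)) f)
  linear_combination f * hlv - s * (v : VField (Smooth S)) f * hκ

theorem rigged_le_zeroFields [SecondCountableTopology S] (hD : IsStarDivisor D) {Ω : BTwoForm D}
    (hΩ : IsStarLogSymplectic D Ω) : rigged Ω ≤ zeroFields D := by
  rintro _ ⟨u, rfl, α, hα⟩ i p hp y
  obtain ⟨ρ, hρD, hρ⟩ := hD.exists_isLeftRegular
  obtain ⟨f, hf⟩ := (hD.curve i).exists_isDefiningAt p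
  have hfp : f p = 0 := hf.eq_zero p hp
  obtain ⟨X, hX⟩ := exists_vField_apply_ne_zero (hf.mfderiv_ne_zero hfp)
  obtain ⟨l, c, hc, hl⟩ := exists_mul_apply_eq hD hf
  obtain ⟨w, hw⟩ := hΩ.bijective_flat.surjective l
  -- `Ω` and the Jacobian are proportional; compare them on `(u, ρX)` and on `(w, ρX)`
  have hprop : f * α X * jac f y w X = c * X f * jac f y u X := by
    have h := flat_mul_jac Ω f y u (smulField ρ hρD X) w (smulField ρ hρD X)
    have hu : flat Ω u (smulField ρ hρD X) = ρ * α X := (hα _).trans (α.map_smul ρ X)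
    have hwl : f * l (smulField ρ hρD X) = c * (ρ * X f) := hl (smulField ρ hρD X)
    have hjac (v : VField (Smooth S)) : jac f y v (smulField ρ hρD X) = ρ * jac f y v X :=
      jac_smul_right f y ρ v X
    rw [hu, hw, hjac, hjac] at h
    refine hρ (hρ ?_)
    change ρ * (ρ * (f * α X * jac f y w X)) = ρ * (ρ * (c * X f * jac f y u X))
    linear_combination f * h + ρ * jac f y u X * hwl
  have huf : (u : VField (Smooth S)) f p = 0 := u.2 i f hf.eq_zero p hp
  have hp0 : f p * α X p * jac f y w X p = c p * X f p *
      ((u : VField (Smooth S)) f p * X y p - (u : VField (Smooth S)) y p * X f p) :=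
    DFunLike.congr_fun hprop p
  simpa [hfp, huf, hc, hX] using hp0

section LocalEquations

variable {f : Fin n → Smooth S} {p : S}

variable (hf : ∀ i, IsDefiningAt (D i) (f i) p) (hF : ∀ q ∈ ⋃ i, D i, (∏ i, f i) q = 0)
include hf

theorem flat_smulField_apply_eq_zero (Ω : BTwoForm D) {i : Fin n} (hp : p ∈ D i)
    {K : VField (Smooth S)} (hK : K (f i) = 0) (w : bFields D) :
    flat Ω (smulField (∏ i, f i) hF K) w p = 0 := by
  have hG (j : Fin n) (hj : j ≠ i) (q : S) (hq : q ∈ D j) :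
      (∏ j ∈ Finset.univ.erase i, f j) q = 0 := by
    obtain ⟨c, hc⟩ := Finset.dvd_prod_of_mem f (Finset.mem_erase.2 ⟨hj, Finset.mem_univ j⟩)
    exact hc ▸ mul_eq_zero_of_left ((hf j).eq_zero q hq) _
  obtain ⟨s, hsp, hs⟩ := exists_smul_mem_bFields (hf i).isEquationAt hG hK
  have hsF : s • smulField (∏ i, f i) hF K = f i • ⟨_, hs⟩ := by
    ext1
    change s • (∏ i, f i) • K = f i • (s * ∏ j ∈ Finset.univ.erase i, f j) • K
    rw [smul_smul, smul_smul, ← Finset.mul_prod_erase _ f (Finset.mem_univ i), mul_left_comm]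
  have h := congrArg (flat Ω · w) hsF
  simp only [map_smul, LinearMap.smul_apply] at h
  have hmul : s p * flat Ω (smulField (∏ i, f i) hF K) w p = f i p * flat Ω ⟨_, hs⟩ w p :=
    DFunLike.congr_fun h p
  rw [(hf i).eq_zero p hp, zero_mul] at hmul
  exact (mul_eq_zero.1 hmul).resolve_left hsp

theorem flat_smulField_smulField_apply_eq_zero (Ω : BTwoForm D) {i : Fin n} (hp : p ∈ D i)
    (U W : VField (Smooth S)) :
    flat Ω (smulField (∏ i, f i) hF U) (smulField (∏ i, f i) hF W) p = 0 := by
  obtain ⟨X, hX⟩ := exists_vField_apply_ne_zero ((hf i).mfderiv_ne_zero ((hf i).eq_zero p hp))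
  have hdep (U : VField (Smooth S)) (w : bFields D) :
      X (f i) p * flat Ω (smulField (∏ i, f i) hF U) w p =
        U (f i) p * flat Ω (smulField (∏ i, f i) hF X) w p := by
    have hK : (X (f i) • U - U (f i) • X) (f i) = 0 := by
      simp only [Derivation.sub_apply, Derivation.smul_apply, smul_eq_mul]
      ring
    have h := flat_smulField_apply_eq_zero hf hF Ω hp hK w
    simp only [map_sub, map_smul, LinearMap.sub_apply, LinearMap.smul_apply, smul_eq_mul] at h
    exact sub_eq_zero.1 h
  have hXW : flat Ω (smulField (∏ i, f i) hF X) (smulField (∏ i, f i) hF W) p = 0 := by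
    have h := hdep W (smulField (∏ i, f i) hF X)
    rw [flat_self, flat_swap] at h
    have h0 : X (f i) p * -flat Ω (smulField (∏ i, f i) hF X) (smulField (∏ i, f i) hF W) p = 0 :=
      h.trans (mul_zero (W (f i) p))
    exact neg_eq_zero.1 ((mul_eq_zero.1 h0).resolve_left hX)
  have h := hdep U (smulField (∏ i, f i) hF W)
  rw [hXW, mul_zero] at h
  exact (mul_eq_zero.1 h).resolve_left hX

end LocalEquations

theorem exists_smul_eq_smul {u : VField (Smooth S)} (hu : u ∈ zeroFields D) {F : Smooth S} {p : S}
    (hF : IsEquationAt (⋃ i, D i) F p) :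
    ∃ (s : Smooth S) (U : VField (Smooth S)), s p ≠ 0 ∧ s • u = F • U := by
  obtain ⟨x, y, X, Y, hJ⟩ := exists_jac_ne_zero p
  obtain ⟨-, t, htp, ht⟩ := hF
  have hu0 (q : S) (hq : q ∈ ⋃ i, D i) (h : Smooth S) : u h q = 0 := by
    obtain ⟨i, hi⟩ := mem_iUnion.1 hq
    exact hu i q hi h
  obtain ⟨a, ha⟩ := ht (jac x y u Y) fun q hq => by
    change u x q * Y y q - u y q * Y x q = 0
    rw [hu0 q hq, hu0 q hq, zero_mul, zero_mul, sub_zero]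
  obtain ⟨b, hb⟩ := ht (jac x y X u) fun q hq => by
    change X x q * u y q - X y q * u x q = 0
    rw [hu0 q hq, hu0 q hq, mul_zero, mul_zero, sub_zero]
  refine ⟨t * jac x y X Y, a • X + b • Y, mul_ne_zero htp hJ, ?_⟩
  rw [mul_smul, jac_smul_eq_add x y X Y u, smul_add, smul_add, smul_smul, smul_smul, smul_smul,
    smul_smul, ha, hb]

theorem flat_apply_eq_zero_of_mem_zeroFields (hD : IsStarDivisor D) (Ω : BTwoForm D)
    {u w : bFields D} (hu : (u : VField (Smooth S)) ∈ zeroFields D)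
    (hw : (w : VField (Smooth S)) ∈ zeroFields D) {p : S} (hp : p ∈ ⋃ i, D i) :
    flat Ω u w p = 0 := by
  obtain ⟨i, hi⟩ := mem_iUnion.1 hp
  obtain ⟨f, hf, hF⟩ := hD.exists_isEquationAt_prod p
  obtain ⟨s, U, hs, hU⟩ := exists_smul_eq_smul hu hF
  obtain ⟨t, W, ht, hW⟩ := exists_smul_eq_smul hw hF
  have hsu : s • u = smulField (∏ i, f i) hF.1 U := Subtype.ext hU
  have htw : t • w = smulField (∏ i, f i) hF.1 W := Subtype.ext hW
  have h := flat_smulField_smulField_apply_eq_zero hf hF.1 Ω hi U W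
  rw [← hsu, ← htw, map_smul, map_smul, LinearMap.smul_apply] at h
  have hst : t p * (s p * flat Ω u w p) = 0 := h
  exact (mul_eq_zero.1 ((mul_eq_zero.1 hst).resolve_left ht)).resolve_left hs

theorem dvd_flat_smulField (hD : IsStarDivisor D) (Ω : BTwoForm D) {ρ : Smooth S}
    (hρD : ∀ q ∈ ⋃ i, D i, ρ q = 0) (hρ : IsLeftRegular ρ) {u : bFields D}
    (hu : (u : VField (Smooth S)) ∈ zeroFields D) (X : VField (Smooth S)) :
    ρ ∣ flat Ω u (smulField ρ hρD X) := by
  refine dvd_of_forall_exists_dvd_mul hρ fun p => ?_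
  obtain ⟨f, -, hFD, s, hs, hdvd⟩ := hD.exists_isEquationAt_prod p
  obtain ⟨κ, hκ⟩ := hdvd ρ hρD
  obtain ⟨e, he⟩ := hdvd _ fun q hq => flat_apply_eq_zero_of_mem_zeroFields hD Ω hu
    (w := smulField (∏ i, f i) hFD X) (smul_mem_zeroFields hFD X) hq
  refine ⟨s * s, mul_ne_zero hs hs, s * e, ?_⟩
  linear_combination s * mul_flat_smulField Ω hρD hFD hκ u X + κ * he - e * hκ

theorem zeroFields_le_rigged [SecondCountableTopology S] (hD : IsStarDivisor D) (Ω : BTwoForm D) :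
    zeroFields D ≤ rigged Ω := by
  intro u hu
  obtain ⟨ρ, hρD, hρ⟩ := hD.exists_isLeftRegular
  let u' : bFields D := ⟨u, zeroFields_le_bFields hu⟩
  obtain ⟨α, hα⟩ := exists_linearMap_mul_eq hρ (flat Ω u' ∘ₗ smulField ρ hρD)
    (dvd_flat_smulField hD Ω hρD hρ hu)
  refine ⟨u', rfl, α, fun v => hρ ?_⟩
  change ρ * flat Ω u' v = ρ * α v
  rw [hα, LinearMap.comp_apply, smulField_coe, map_smul, smul_eq_mul]

theorem rigged_eq_zeroFields [SecondCountableTopology S] (hD : IsStarDivisor D) {Ω : BTwoForm D}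
    (hΩ : IsStarLogSymplectic D Ω) : rigged Ω = zeroFields D :=
  le_antisymm (rigged_le_zeroFields hD hΩ) (zeroFields_le_rigged hD Ω)

end Rigged

section Transport

variable {R : Type*} [CommRing R] [Algebra ℝ R] {A B : Type*} [AddCommGroup A] [Module R A]
  [AddCommGroup B] [Module R B]

/-- Transport of forms along an isomorphism of modules of sections. -/
noncomputable def formCongr (e : A ≃ₗ[R] B) (k : ℕ) : Form R A k ≃ₗ[ℝ] Form R B k :=
  AlternatingMap.domLCongr R R (Fin k) ℝ e

theorem formCongr_comp (e : A ≃ₗ[R] B) {k : ℕ} (β : Form R A k) (v : Fin k → A) :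
    formCongr e k β (e ∘ v) = β v :=
  congrArg β (funext fun i => e.symm_apply_apply (v i))

variable {brA : A → A → A} {ρA : A → VField R} {brB : B → B → B} {ρB : B → VField R}
  (e : A ≃ₗ[R] B)

theorem bracketPart_formCongr (hbr : ∀ a b, e (brA a b) = brB (e a) (e b)) {k : ℕ}
    (β : Form R A k) (v : Fin (k + 1) → A) :
    bracketPart brB (formCongr e k β) (e ∘ v) = bracketPart brA β v := by
  cases k with
  | zero => rfl
  | succ m =>
    refine Finset.sum_congr rfl fun j _ => Finset.sum_congr rfl fun i _ => congrArg _ ?_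
    rw [← formCongr_comp e, Fin.comp_cons, hbr]
    rfl

variable (hρ : ∀ a, ρB (e a) = ρA a) (hbr : ∀ a b, e (brA a b) = brB (e a) (e b))
include hρ hbr

theorem algebroidD_formCongr {k : ℕ} (β : Form R A k) (v : Fin (k + 1) → A) :
    algebroidD brB ρB (formCongr e k β) (e ∘ v) = algebroidD brA ρA β v := by
  refine congrArg₂ _ (Finset.sum_congr rfl fun i _ => ?_) (bracketPart_formCongr e hbr β v)
  rw [← formCongr_comp e, ← hρ]
  rfl

theorem formCongr_mem_cocycles {k : ℕ} (β : Form R A k) :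
    formCongr e k β ∈ cocycles R brB ρB k ↔ β ∈ cocycles R brA ρA k :=
  e.surjective.comp_left.forall.trans
    (forall_congr' fun v => by rw [algebroidD_formCongr e hρ hbr])

theorem formCongr_mem_coboundaries {k : ℕ} (β : Form R A k) :
    formCongr e k β ∈ coboundaries R brB ρB k ↔ β ∈ coboundaries R brA ρA k := by
  cases k with
  | zero => exact (formCongr e 0).map_eq_zero_iff
  | succ k =>
    refine (formCongr e k).surjective.exists.trans (exists_congr fun γ =>
      e.surjective.comp_left.forall.trans (forall_congr' fun v => ?_))
    rw [algebroidD_formCongr e hρ hbr, formCongr_comp]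

/-- The isomorphism in cohomology induced by an isomorphism of Lie algebroids, that is, by an
isomorphism of the modules of sections that respects the anchors and the brackets. -/
noncomputable def cohomologyCongr (k : ℕ) :
    AlgebroidCohomology R brA ρA k ≃ₗ[ℝ] AlgebroidCohomology R brB ρB k :=
  let E : cocycles R brA ρA k ≃ₗ[ℝ] cocycles R brB ρB k :=
    (formCongr e k).ofSubmodules _ _ <|
      (Submodule.ext (formCongr_mem_cocycles e hρ hbr) :
          (cocycles R brB ρB k).comap (formCongr e k).toLinearMap = cocycles R brA ρA k) ▸
        Submodule.map_comap_eq_of_surjective (formCongr e k).surjective _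
  Submodule.Quotient.equiv _ _ E <|
    (Submodule.ext fun β => formCongr_mem_coboundaries e hρ hbr β.1 :
        ((coboundaries R brB ρB k).submoduleOf (cocycles R brB ρB k)).comap E.toLinearMap =
          (coboundaries R brA ρA k).submoduleOf (cocycles R brA ρA k)) ▸
      Submodule.map_comap_eq_of_surjective E.surjective _

end Transport

section Sharp

variable {R A : Type*} [CommRing R] [Algebra ℝ R] [AddCommGroup A] [Module R A]

theorem algebroidD_twoForm (br : A → A → A) (ρ : A → VField R) (Ω : A [⋀^Fin 2]→ₗ[R] R)
    (u v w : A) : algebroidD br ρ Ω ![u, v, w] =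
      ρ u (flat Ω v w) - ρ v (flat Ω u w) + ρ w (flat Ω u v) - flat Ω (br u v) w +
        flat Ω (br u w) v - flat Ω (br v w) u := by
  have hΩ (f : Fin 2 → A) : Ω f = flat Ω (f 0) (f 1) :=
    congrArg Ω (funext fun i => by fin_cases i <;> rfl)
  have hIic₀ : Finset.Iic (0 : Fin 2) = {0} := rfl
  have hIic₁ : Finset.Iic (1 : Fin 2) = {0, 1} := rfl
  change (∑ i : Fin 3, (-1 : R) ^ (i : ℕ) * ρ (![u, v, w] i)
      (Ω fun l => ![u, v, w] (i.succAbove l))) +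
    ∑ j : Fin 2, ∑ i ∈ Finset.Iic j, (-1 : R) ^ ((i : ℕ) + ((j : ℕ) + 1)) *
      Ω (Fin.cons (br (![u, v, w] i.castSucc) (![u, v, w] j.succ))
        fun l => ![u, v, w] (j.succ.succAbove (i.succAbove l))) = _
  simp only [hΩ, Fin.sum_univ_three, Fin.sum_univ_two, hIic₀, hIic₁, Finset.sum_singleton,
    Finset.sum_pair (zero_ne_one (α := Fin 2))]
  change (-1) ^ 0 * ρ u (flat Ω v w) + (-1) ^ 1 * ρ v (flat Ω u w) + (-1) ^ 2 * ρ w (flat Ω u v) +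
    ((-1) ^ (0 + (0 + 1)) * flat Ω (br u v) w + ((-1) ^ (0 + (1 + 1)) * flat Ω (br u w) v +
      (-1) ^ (1 + (1 + 1)) * flat Ω (br v w) u)) = _
  ring

/-- The map `π♯`, as an `R`-linear map. -/
def sharpLinear (π : Bivector R) : OneForm R →ₗ[R] VField R where
  toFun := sharp π
  map_add' α β := Derivation.ext fun f =>
    DFunLike.congr_fun ((flat π).map_add α β) (dFun f)
  map_smul' r α := Derivation.ext fun f =>
    DFunLike.congr_fun ((flat π).map_smul r α) (dFun f)

end Sharp

section Poisson

variable {S : Type*} [TopologicalSpace S] [ChartedSpace (EuclideanSpace ℝ (Fin 2)) S]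
  {n : ℕ} {D : Fin n → Set S} {Ω : BTwoForm D} {π : Bivector (Smooth S)}

theorem exists_sharp_eq (hΩ : IsStarLogSymplectic D Ω) (hπ : IsInverse D Ω π)
    (α : OneForm (Smooth S)) :
    ∃ u : bFields D, sharp π α = u ∧ ∀ v : bFields D, flat Ω u v = α v := by
  obtain ⟨u, hu, -⟩ := hΩ.nondegenerate (α.comp (bFields D).subtype)
  exact ⟨u, hπ α u hu, hu⟩

theorem range_sharpLinear (hΩ : IsStarLogSymplectic D Ω) (hπ : IsInverse D Ω π) :
    LinearMap.range (sharpLinear π) = rigged Ω := by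
  refine le_antisymm ?_ ?_
  · rintro _ ⟨α, rfl⟩
    obtain ⟨u, hu, hα⟩ := exists_sharp_eq hΩ hπ α
    exact ⟨u, hu.symm, α, hα⟩
  · rintro _ ⟨u, rfl, α, hα⟩
    exact ⟨α, hπ α u hα⟩

variable [T2Space S] [IsManifold (𝓡 2) ∞ S]

theorem flat_bivector_apply (π : Bivector (Smooth S)) (α β : OneForm (Smooth S)) :
    flat π α β = β (sharp π α) := by
  ext p
  obtain ⟨x, y, X, Y, hJ⟩ := exists_jac_ne_zero p
  have hβ : jac x y X Y • β =
      (β X * Y y - β Y * X y) • dFun x + (β Y * X x - β X * Y x) • dFun y := by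
    ext Z : 1
    have h := congrArg β (jac_smul_eq_add x y X Y Z)
    rw [map_smul, map_add, map_smul, map_smul] at h
    refine h.trans ?_
    change (Z x * Y y - Z y * Y x) * β X + (X x * Z y - X y * Z x) * β Y =
      (β X * Y y - β Y * X y) * Z x + (β Y * X x - β X * Y x) * Z y
    ring
  have h : jac x y X Y • flat π α β = jac x y X Y • β (sharp π α) := by
    rw [← map_smul, hβ, map_add, map_smul, map_smul]
    exact (DFunLike.congr_fun hβ (sharp π α)).symm
  exact mul_left_cancel₀ hJ (DFunLike.congr_fun h p)

theorem sharp_cotangentBracket (hΩ : IsStarLogSymplectic D Ω) (hπ : IsInverse D Ω π)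
    (α β : OneForm (Smooth S)) :
    sharp π (cotangentBracket π α β) = ⁅sharp π α, sharp π β⁆ := by
  obtain ⟨u, hu, hα⟩ := exists_sharp_eq hΩ hπ α
  obtain ⟨v, hv, hβ⟩ := exists_sharp_eq hΩ hπ β
  rw [cotangentBracket, hu, hv]
  refine hπ _ (bBracket D u v) fun w => ?_
  change flat Ω (bBracket D u v) w = ((u : VField (Smooth S)) (β w) - β (bBracket D u w)) -
    ((v : VField (Smooth S)) (α w) - α (bBracket D v w)) - (w : VField (Smooth S)) (flat π α β)
  have hπw : (w : VField (Smooth S)) (flat π α β) = -(w : VField (Smooth S)) (flat Ω u v) := by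
    rw [flat_bivector_apply, hu, ← hβ, flat_swap]
    exact w.1.map_neg (flat Ω u v)
  have hclosed := hΩ.closed ![u, v, w]
  rw [algebroidD_twoForm, hα w, hβ w, flat_swap Ω v (bBracket D u w), hβ,
    flat_swap Ω u (bBracket D v w), hα (bBracket D v w)] at hclosed
  linear_combination hπw - hclosed

theorem sharpLinear_injective [SecondCountableTopology S] (hD : IsStarDivisor D)
    (hΩ : IsStarLogSymplectic D Ω) (hπ : IsInverse D Ω π) :
    Function.Injective (sharpLinear π) := by
  refine (injective_iff_map_eq_zero _).2 fun α hα => ?_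
  obtain ⟨ρ, hρD, hρ⟩ := hD.exists_isLeftRegular
  obtain ⟨u, hu, huα⟩ := exists_sharp_eq hΩ hπ α
  obtain rfl : u = 0 := Subtype.ext (hu.symm.trans hα)
  have hρα (X : VField (Smooth S)) : ρ * α X = ρ * 0 := by
    have h := huα (smulField ρ hρD X)
    rw [map_zero, LinearMap.zero_apply] at h
    exact (α.map_smul ρ X).symm.trans (h.symm.trans (mul_zero ρ).symm)
  exact LinearMap.ext fun X => hρ (hρα X)

/-- The isomorphism `π♯` from the one-forms to the sections of the zero tangent bundle. -/
noncomputable def sharpEquiv [SecondCountableTopology S] (hD : IsStarDivisor D)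
    (hΩ : IsStarLogSymplectic D Ω) (hπ : IsInverse D Ω π) :
    OneForm (Smooth S) ≃ₗ[Smooth S] zeroFields D :=
  (LinearEquiv.ofInjective (sharpLinear π) (sharpLinear_injective hD hΩ hπ)).trans
    (LinearEquiv.ofEq _ _ ((range_sharpLinear hΩ hπ).trans (rigged_eq_zeroFields hD hΩ)))

theorem coe_sharpEquiv [SecondCountableTopology S] (hD : IsStarDivisor D)
    (hΩ : IsStarLogSymplectic D Ω) (hπ : IsInverse D Ω π) (α : OneForm (Smooth S)) :
    (sharpEquiv hD hΩ hπ α : VField (Smooth S)) = sharp π α := rfl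

theorem sharpEquiv_cotangentBracket [SecondCountableTopology S] (hD : IsStarDivisor D)
    (hΩ : IsStarLogSymplectic D Ω) (hπ : IsInverse D Ω π) (α β : OneForm (Smooth S)) :
    sharpEquiv hD hΩ hπ (cotangentBracket π α β) =
      zeroBracket D (sharpEquiv hD hΩ hπ α) (sharpEquiv hD hΩ hπ β) :=
  Subtype.ext (sharp_cotangentBracket hΩ hπ α β)

end Poisson

end StarLog

theorem lemma4p1 {S : Type*} [TopologicalSpace S] [T2Space S] [SecondCountableTopology S]
    [ChartedSpace (EuclideanSpace ℝ (Fin 2)) S] [IsManifold (𝓡 2) ∞ S]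
    {n : ℕ} (D : Fin n → Set S) (hD : StarLog.IsStarDivisor D)
    (Ω : StarLog.BTwoForm D) (hΩ : StarLog.IsStarLogSymplectic D Ω)
    (π : StarLog.Bivector (StarLog.Smooth S)) (hπ : StarLog.IsInverse D Ω π) :
    (∀ k : ℕ, Nonempty (StarLog.PoissonCohomology π k ≃ₗ[ℝ] StarLog.ZeroCohomology D k)) ∧
      StarLog.rigged Ω = StarLog.zeroFields D :=
  ⟨fun k => ⟨StarLog.cohomologyCongr (StarLog.sharpEquiv hD hΩ hπ)
    (StarLog.coe_sharpEquiv hD hΩ hπ) (StarLog.sharpEquiv_cotangentBracket hD hΩ hπ) k⟩,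
    StarLog.rigged_eq_zeroFields hD hΩ⟩
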